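/- Let $M$ be a smooth manifold of dimension $m$ and let $(E,\langle\cdot,\cdot\rangle,\circ,\rho)$ be a Courant algebroid over $M$ of rank $2n$: $E\to M$ is a smooth vector bundle with a smooth fibrewise nondegenerate symmetric bilinear form $\langle\cdot,\cdot\rangle$, a smooth bundle map $\rho:E\to TM$ and an $\mathbb R$-bilinear operation $\circ$ on $\Gamma(E)$ such that for all sections (1) $e_1\circ(e_2\circ e_3)=(e_1\circ e_2)\circ e_3+e_2\circ(e_1\circ e_3)$, (2) $\rho(e)\langle e_1,e_2\rangle=\langle e\circ e_1,e_2\rangle+\langle e_1,e\circ e_2\rangle$, (3) $e_1\circ e_2+e_2\circ e_1=D\langle e_1,e_2\rangle$, where $\langle Df,e\rangle=\rho(e)f$. A subbundle $A\subset E$ over $M$ is a Dirac structure if it is maximally isotropic and $\Gamma(A)$ is closed under $\circ$. Let $A\subset E$ be a smooth subbundle of rank $n$ and let $\mathcal B=\{\langle a,\cdot\rangle : a\in A\}\subset E^*$. The graded manifold $\mathcal E$ of $E$ has $\mathcal E_{-1}=E^*[1]$ and $\mathcal E_{-2}=T^*[2]M$. A Darboux chart $(q^i,\xi^a,p_i)$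 of $\mathcal E$ (of degrees $0,1,2$) is given by local coordinates $q^i$ of $M$ and a frame $\xi^1,\dots,\xi^{2n}$ of $E$ over their domain $U$ with constant $g^{ab}=\langle\xi^a,\xi^b\rangle$; it is adapted to $A$ if $\xi^1,\dots,\xi^n$ is a frame of $A|_U$. In it $$\pi=\frac{\partial}{\partial q^i}\frac{\partial}{\partial p_i}+\frac12 g^{ab}\frac{\partial}{\partial\xi^a}\frac{\partial}{\partial\xi^b},\qquad \Theta=f_a^i\xi^ap_i-\frac16h_{abc}\xi^a\xi^b\xi^c,$$ with $g^{ab}f_b^i=\rho(\xi^a)q^i$ and $g^{aa'}g^{bb'}g^{cc'}h_{a'b'c'}=\langle\xi^a\circ\xi^b,\xi^c\rangle$, and $X_\Theta=\iota_\Theta\pi=\{\Theta,\cdot\}$ is the Hamiltonian vector field of $\Theta$ (with $\{p_i,q^j\}=\delta_i^j$, $\{\xi^a,\xi^b\}=g^{ab}$). Say that $Q=\pi+X_\Theta$ vanishes on the conormal bundle of $\mathcal B[1]$ in the chart if, for all $x\in U$, all $l\ge 0$ and all covectors $\alpha_1,\dots,\alpha_l\in\{\alpha\in (E_x^*)^*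 : \alpha|_{\mathcal B_x}=0\}$ (the conormal space of $\mathcal B[1]$ in $\mathcal E_{-1}$ at $x$), the function $Q(\alpha_1,\dots,\alpha_l)$, i.e. the multiplicity-zero part of the $l$-fold contraction of $Q$, is zero when restricted to $p=0$ and to the fibre $\mathcal B_x[1]$, as an element of $\wedge \mathcal B_x^*$. The submanifold $\mathcal B[1]\subset\mathcal E$ is of coisotropic type with respect to $\pi+X_\Theta$ if every point of $M$ lies in the domain of a Darboux chart adapted to $A$ in which $Q$ vanishes on the conormal bundle of $\mathcal B[1]$. Then $A$ is a Dirac structure if and only if $\mathcal B[1]\subset\mathcal E$ is of coisotropic type with respect to $\pi+X_\Theta$. Moreover, in that case $Q$ vanishes on the conormal bundle of $\mathcal B[1]$ in every Darboux chart adapted to $A$, so that the condition does not depend on the choice of adapted charts. -/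

import Mathlib

open scoped Manifold ContDiff TensorProduct Bundle

noncomputable section

namespace CourantDirac

/-! ### Courant algebroids, subbundles, Dirac structures -/

section Courant

variable (m : ℕ) (M : Type*) [TopologicalSpace M] [ChartedSpace (EuclideanSpace ℝ (Fin m)) M]
  [IsManifold (𝓡 m) ∞ M]
  (F : Type*) [NormedAddCommGroup F] [NormedSpace ℝ F]
  (E : M → Type*) [TopologicalSpace (Bundle.TotalSpace F E)]
  [∀ x, AddCommGroup (E x)] [∀ x, Module ℝ (E x)] [∀ x, TopologicalSpace (E x)]
  [FiberBundle F E] [VectorBundle ℝ F E]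

/-- A Courant algebroid structure on the smooth vector bundle `E → M` (`M` a smooth manifold of
dimension `m`): a fibrewise nondegenerate symmetric pairing, an anchor `ρ : E → TM`, both smooth
(they send smooth sections to smooth functions, resp. to smooth vector fields), and the Dorfman
bracket on the smooth sections of `E`. -/
structure CourantAlgebroid where
  /-- the pseudo-inner product `⟨·,·⟩` -/
  pairing : ∀ x : M, E x →ₗ[ℝ] E x →ₗ[ℝ] ℝ
  pairing_symm : ∀ x u v, pairing x u v = pairing x v u
  pairing_nondeg : ∀ x u, (∀ v, pairing x u v = 0) → u = 0
  pairing_smooth : ∀ s t : Cₛ^∞⟮𝓡 m; F, E⟯,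
    ContMDiff (𝓡 m) 𝓘(ℝ, ℝ) ∞ (fun x => pairing x (s x) (t x))
  /-- the anchor `ρ` -/
  anchor : ∀ x : M, E x →ₗ[ℝ] TangentSpace (𝓡 m) x
  anchor_smooth : ∀ s : Cₛ^∞⟮𝓡 m; F, E⟯,
    ContMDiff (𝓡 m) (𝓡 m).tangent ∞
      (fun x => (⟨x, anchor x (s x)⟩ : TangentBundle (𝓡 m) M))
  /-- the Dorfman bracket `e₁ ∘ e₂` -/
  bracket : Cₛ^∞⟮𝓡 m; F, E⟯ →ₗ[ℝ] Cₛ^∞⟮𝓡 m; F, E⟯ →ₗ[ℝ] Cₛ^∞⟮𝓡 m; F, E⟯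
  /-- `e₁ ∘ (e₂ ∘ e₃) = (e₁ ∘ e₂) ∘ e₃ + e₂ ∘ (e₁ ∘ e₃)` -/
  bracket_jacobi : ∀ e₁ e₂ e₃, bracket e₁ (bracket e₂ e₃) =
    bracket (bracket e₁ e₂) e₃ + bracket e₂ (bracket e₁ e₃)
  /-- `ρ(e)⟨e₁,e₂⟩ = ⟨e ∘ e₁, e₂⟩ + ⟨e₁, e ∘ e₂⟩` -/
  anchor_pairing : ∀ (e e₁ e₂ : Cₛ^∞⟮𝓡 m; F, E⟯) (x : M),
    mfderiv (𝓡 m) 𝓘(ℝ, ℝ) (fun y => pairing y (e₁ y) (e₂ y)) x (anchor x (e x)) =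
      pairing x (bracket e e₁ x) (e₂ x) + pairing x (e₁ x) (bracket e e₂ x)
  /-- `e₁ ∘ e₂ + e₂ ∘ e₁ = D⟨e₁,e₂⟩`, where `⟨D f, e⟩ = ρ(e) f` for every section `e` -/
  bracket_symm_part : ∀ (e₁ e₂ e : Cₛ^∞⟮𝓡 m; F, E⟯) (x : M),
    pairing x ((bracket e₁ e₂ + bracket e₂ e₁) x) (e x) =
      mfderiv (𝓡 m) 𝓘(ℝ, ℝ) (fun y => pairing y (e₁ y) (e₂ y)) x (anchor x (e x))

variable {M E}

/-- A family of subspaces of the fibres is a smooth subbundle of rank `k` over `M` if near every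
point it has a frame of `k` smooth sections. (Local sections near a point extend, after shrinking
the neighbourhood, to global ones.) -/
def IsSubbundle (A : ∀ x, Submodule ℝ (E x)) (k : ℕ) : Prop :=
  ∀ x : M, ∃ U : Set M, IsOpen U ∧ x ∈ U ∧ ∃ s : Fin k → Cₛ^∞⟮𝓡 m; F, E⟯,
    ∀ y ∈ U, LinearIndependent ℝ (fun i => s i y) ∧
      A y = Submodule.span ℝ (Set.range fun i => s i y)

variable {m F}

/-- A subspace of a fibre is isotropic if the pairing vanishes on it. -/
def IsIsotropic (𝒞 : CourantAlgebroid m M F E) {x : M} (W : Submodule ℝ (E x)) : Prop :=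
  ∀ u ∈ W, ∀ v ∈ W, 𝒞.pairing x u v = 0

/-- A subbundle is a Dirac structure if it is maximally isotropic and its sections are closed under
the Dorfman bracket. -/
structure IsDirac (𝒞 : CourantAlgebroid m M F E) (A : ∀ x, Submodule ℝ (E x)) : Prop where
  maximal_isotropic : ∀ x, Maximal (IsIsotropic 𝒞) (A x)
  bracket_mem : ∀ e₁ e₂ : Cₛ^∞⟮𝓡 m; F, E⟯, (∀ x, e₁ x ∈ A x) → (∀ x, e₂ x ∈ A x) →
    ∀ x, 𝒞.bracket e₁ e₂ x ∈ A x

/-- The subbundle `ℬ` of `E*` corresponding to `A` under the identification `E ≅ E*`,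
`e ↦ ⟨e,·⟩`. -/
def dualSubbundle (𝒞 : CourantAlgebroid m M F E) (A : ∀ x, Submodule ℝ (E x)) (x : M) :
    Submodule ℝ (Module.Dual ℝ (E x)) :=
  (A x).map (𝒞.pairing x)

end Courant

/-! ### Multivector fields on a coordinate chart of the graded manifold

A Darboux chart of the graded manifold `ℰ` (`ℰ₋₁ = E*[1]`, `ℰ₋₂ = T*[2]M`) has coordinates `qⁱ` of
degree `0`, `ξᵃ` of degree `1` and `pᵢ` of degree `2`. With respect to the total degree (degree plus
multiplicity) the generators `pᵢ` and `∂/∂ξᵃ` of the algebra of multivector fields are even, while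
`ξᵃ`, `∂/∂qⁱ` and `∂/∂pᵢ` are odd. -/

section Multivector

variable {m : ℕ}

/-- The smooth real functions of the coordinates `qⁱ` on an open set `Ω`; they are functions on the
whole space of which only the restriction to `Ω` matters. -/
def SmoothFun (Ω : TopologicalSpace.Opens (EuclideanSpace ℝ (Fin m))) :
    Subalgebra ℝ (EuclideanSpace ℝ (Fin m) → ℝ) where
  carrier := {f | ContDiffOn ℝ ∞ f Ω}
  mul_mem' hf hg := ContDiffOn.mul hf hg
  add_mem' hf hg := ContDiffOn.add hf hg
  algebraMap_mem' _ := contDiffOn_const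

/-- The partial derivative `∂f/∂qⁱ` (extended by zero outside of `Ω`). -/
def partialQ (Ω : TopologicalSpace.Opens (EuclideanSpace ℝ (Fin m))) (i : Fin m) :
    SmoothFun Ω →ₗ[ℝ] SmoothFun Ω where
  toFun f := ⟨(Ω : Set (EuclideanSpace ℝ (Fin m))).indicator
      (fun y => fderiv ℝ f.1 y (EuclideanSpace.single i 1)), by
    have h : ContDiffOn ℝ ∞ (fun y => fderiv ℝ f.1 y (EuclideanSpace.single i 1))
        (Ω : Set (EuclideanSpace ℝ (Fin m))) :=
      ((show ContDiffOn ℝ ∞ f.1 Ω from f.2).fderiv_of_isOpen Ω.isOpen (by simp)).clm_apply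
        contDiffOn_const
    exact h.congr fun y hy => Set.indicator_of_mem hy _⟩
  map_add' f g := by
    ext y
    by_cases hy : y ∈ (Ω : Set (EuclideanSpace ℝ (Fin m)))
    · have hf := ((show ContDiffOn ℝ ∞ f.1 Ω from f.2).contDiffAt
        (Ω.isOpen.mem_nhds hy)).differentiableAt (by simp)
      have hg := ((show ContDiffOn ℝ ∞ g.1 Ω from g.2).contDiffAt
        (Ω.isOpen.mem_nhds hy)).differentiableAt (by simp)
      simp [Set.indicator_of_mem hy, fderiv_add hf hg]
    · simp [Set.indicator_of_notMem hy]
  map_smul' c f := by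
    ext y
    by_cases hy : y ∈ (Ω : Set (EuclideanSpace ℝ (Fin m)))
    · have hf := ((show ContDiffOn ℝ ∞ f.1 Ω from f.2).contDiffAt
        (Ω.isOpen.mem_nhds hy)).differentiableAt (by simp)
      simp [Set.indicator_of_mem hy, fderiv_const_smul hf]
    · simp [Set.indicator_of_notMem hy]

/-- The even generators `pᵢ` and `∂/∂ξᵃ`. -/
inductive EvenGen (m : ℕ) (ι : Type) : Type
  | p (i : Fin m) : EvenGen m ι
  | dxi (a : ι) : EvenGen m ι

/-- The odd generators `ξᵃ`, `∂/∂qⁱ` and `∂/∂pᵢ`. -/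
inductive OddGen (m : ℕ) (ι : Type) : Type
  | xi (a : ι) : OddGen m ι
  | dq (i : Fin m) : OddGen m ι
  | dp (i : Fin m) : OddGen m ι

/-- The algebra homomorphism `a ⊗ b ⊗ d ↦ f(a) g(b) h(d)`. -/
def tensorEval {A B D D' : Type*} [CommRing A] [Algebra ℝ A] [CommRing B] [Algebra ℝ B]
    [Ring D] [Algebra ℝ D] [Ring D'] [Algebra ℝ D']
    (f : A →ₐ[ℝ] ℝ) (g : B →ₐ[ℝ] ℝ) (h : D →ₐ[ℝ] D') : A ⊗[ℝ] (B ⊗[ℝ] D) →ₐ[ℝ] D' :=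
  (Algebra.TensorProduct.lid ℝ D').toAlgHom.comp
    (Algebra.TensorProduct.map f
      ((Algebra.TensorProduct.lid ℝ D').toAlgHom.comp (Algebra.TensorProduct.map g h)))

variable (Ω : TopologicalSpace.Opens (EuclideanSpace ℝ (Fin m))) (ι : Type)

/-- The graded commutative algebra of multivector fields on the chart: polynomials in the even
generators and exterior polynomials in the odd generators, with coefficients the smooth functions
of `q`. Functions are the multivector fields of multiplicity zero. -/
def Multivector : Type :=
  SmoothFun Ω ⊗[ℝ] (MvPolynomial (EvenGen m ι) ℝ ⊗[ℝ] ExteriorAlgebra ℝ (OddGen m ι →₀ ℝ))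

instance : Ring (Multivector Ω ι) := Algebra.TensorProduct.instRing

instance : Algebra ℝ (Multivector Ω ι) := Algebra.TensorProduct.leftAlgebra

namespace Multivector

variable {Ω ι}

/-- The product `f P η` of a function `f` of `q`, a polynomial `P` in the even generators and an
exterior polynomial `η` in the odd generators. -/
def mk (f : SmoothFun Ω) (P : MvPolynomial (EvenGen m ι) ℝ)
    (η : ExteriorAlgebra ℝ (OddGen m ι →₀ ℝ)) : Multivector Ω ι :=
  TensorProduct.tmul ℝ f (TensorProduct.tmul ℝ P η)

/-- A function of `q`, as a function on the chart. -/
def ofFun (f : SmoothFun Ω) : Multivector Ω ι := mk f 1 1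

/-- An even generator. -/
def even (v : EvenGen m ι) : Multivector Ω ι := mk 1 (MvPolynomial.X v) 1

/-- An odd generator. -/
def odd (v : OddGen m ι) : Multivector Ω ι := mk 1 1 (ExteriorAlgebra.ι ℝ (Finsupp.single v 1))

/-- The derivative with respect to `qⁱ` of the coefficients. -/
def derivQ (i : Fin m) : Multivector Ω ι →ₗ[ℝ] Multivector Ω ι :=
  LinearMap.rTensor (MvPolynomial (EvenGen m ι) ℝ ⊗[ℝ] ExteriorAlgebra ℝ (OddGen m ι →₀ ℝ))
    (partialQ Ω i)

/-- The derivative with respect to an even generator. -/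
def derivEven (v : EvenGen m ι) : Multivector Ω ι →ₗ[ℝ] Multivector Ω ι :=
  LinearMap.lTensor (SmoothFun Ω)
    (LinearMap.rTensor (ExteriorAlgebra ℝ (OddGen m ι →₀ ℝ)) (MvPolynomial.pderiv v).toLinearMap)

/-- The right derivative with respect to an odd generator. -/
def derivOdd (v : OddGen m ι) : Multivector Ω ι →ₗ[ℝ] Multivector Ω ι :=
  LinearMap.lTensor (SmoothFun Ω) (LinearMap.lTensor (MvPolynomial (EvenGen m ι) ℝ)
    (CliffordAlgebra.contractRight.flip (Finsupp.lapply v)))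

variable [Fintype ι]

/-- The Poisson bivector field
`π = ∑ᵢ ∂/∂qⁱ ∂/∂pᵢ + ½ ∑ₐᵦ gᵃᵇ ∂/∂ξᵃ ∂/∂ξᵇ` for constants `gᵃᵇ`. -/
def poisson (g : Matrix ι ι ℝ) : Multivector Ω ι :=
  ∑ i, odd (.dq i) * odd (.dp i) +
    (1 / 2 : ℝ) • ∑ a, ∑ b, g a b • (even (.dxi a) * even (.dxi b))

/-- The function `∑ fₐⁱ ξᵃ pᵢ - ⅙ ∑ hₐᵦ꜀ ξᵃ ξᵇ ξᶜ`. -/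
def cubic (f : ι → Fin m → SmoothFun Ω) (h : ι → ι → ι → SmoothFun Ω) : Multivector Ω ι :=
  ∑ a, ∑ i, ofFun (f a i) * odd (.xi a) * even (.p i) -
    (1 / 6 : ℝ) • ∑ a, ∑ b, ∑ d, ofFun (h a b d) * (odd (.xi a) * odd (.xi b) * odd (.xi d))

/-- The contraction `ι_Θ Z = ∑_z (∂Θ/∂z) (Z ⌊ dz)` of a multivector field `Z` with `dΘ`, the sum
being over all the coordinates `z` of the chart. For `Z = π` this is the Hamiltonian vector field
`X_Θ = {Θ,·}`, with `{pᵢ,qʲ} = δᵢʲ` and `{ξᵃ,ξᵇ} = gᵃᵇ`. -/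
def contract (Θ Z : Multivector Ω ι) : Multivector Ω ι :=
  ∑ i, derivQ i Θ * derivOdd (.dq i) Z + ∑ i, derivEven (.p i) Θ * derivOdd (.dp i) Z +
    ∑ a, derivOdd (.xi a) Θ * derivEven (.dxi a) Z

/-- The contraction of a multivector field with the covector `∑ₐ αₐ dξᵃ`. -/
def contractCovector (α : ι → ℝ) (Z : Multivector Ω ι) : Multivector Ω ι :=
  ∑ a, α a • derivEven (.dxi a) Z

/-- The value at the point with coordinates `y` of the multiplicity zero part of a multivector
field, restricted to the graded submanifold `ℬ[1]` of `ℰ₋₁ = E*[1]`: all `pᵢ`, `∂/∂qⁱ`, `∂/∂pᵢ`,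
`∂/∂ξᵃ` are set to zero and the linear coordinates `ξᵃ` are restricted to the fibre `W` of `ℬ`. Here
`V` is the fibre of `E`, `v a : V` is the value of the frame `ξᵃ`, and the functions on the fibre
`W[1]` of `ℬ[1]` form the exterior algebra of `W*`. -/
def restrict {V : Type*} [AddCommGroup V] [Module ℝ V] (v : ι → V)
    (W : Submodule ℝ (Module.Dual ℝ V)) (y : EuclideanSpace ℝ (Fin m)) :
    Multivector Ω ι →ₐ[ℝ] ExteriorAlgebra ℝ (Module.Dual ℝ W) :=
  tensorEval ((Pi.evalAlgHom ℝ _ y).comp (SmoothFun Ω).val)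
    (MvPolynomial.aeval fun _ => (0 : ℝ))
    (ExteriorAlgebra.map (Finsupp.linearCombination ℝ fun w : OddGen m ι => match w with
      | .xi a => (Module.Dual.eval ℝ V (v a)).comp W.subtype
      | .dq _ => 0
      | .dp _ => 0))

/-- The vanishing at one point of a multivector field `Q` on the conormal directions of `ℬ[1]` in
`ℰ₋₁`, i.e. `Q(α₁, …, αₗ)|_{ℬ[1]} = 0` for all `l` and all conormal covectors `α₁, …, αₗ` at that
point. The base of `ℬ[1]` being all of `M`, a conormal covector is a covector `α = ∑ₐ αₐ dξᵃ`
that vanishes on the fibre `W` of `ℬ`. -/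
def VanishesOnConormal {V : Type*} [AddCommGroup V] [Module ℝ V] (v : ι → V)
    (W : Submodule ℝ (Module.Dual ℝ V)) (y : EuclideanSpace ℝ (Fin m))
    (Q : Multivector Ω ι) : Prop :=
  ∀ αs : List (ι → ℝ), (∀ α ∈ αs, ∀ β ∈ W, β (∑ a, α a • v a) = 0) →
    restrict v W y (αs.foldr contractCovector Q) = 0

end Multivector

end Multivector

/-! ### Darboux charts and submanifolds of coisotropic type -/

section Darboux

variable {m : ℕ} {M : Type*} [TopologicalSpace M] [ChartedSpace (EuclideanSpace ℝ (Fin m)) M]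
  [IsManifold (𝓡 m) ∞ M]
  {F : Type*} [NormedAddCommGroup F] [NormedSpace ℝ F]
  {E : M → Type*} [TopologicalSpace (Bundle.TotalSpace F E)]
  [∀ x, AddCommGroup (E x)] [∀ x, Module ℝ (E x)] [∀ x, TopologicalSpace (E x)]
  [FiberBundle F E] [VectorBundle ℝ F E]

/-- The data `(qⁱ, ξᵃ)` that determine a Darboux chart `(qⁱ, ξᵃ, pᵢ)` of `ℰ`: a coordinate chart of
`M` and a frame `ξᵃ` of `E` over its domain for which the functions `gᵃᵇ = ⟨ξᵃ,ξᵇ⟩` are constant.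
The frame is given by global sections of `E`, of which only the restriction to the domain is used;
locally every frame is of this form. -/
structure DarbouxChart (𝒞 : CourantAlgebroid m M F E) (ι : Type) where
  /-- the coordinates `qⁱ` of `M` -/
  chart : OpenPartialHomeomorph M (EuclideanSpace ℝ (Fin m))
  chart_mem : chart ∈ IsManifold.maximalAtlas (𝓡 m) ∞ M
  /-- the frame `ξᵃ` of `E` -/
  frame : ι → Cₛ^∞⟮𝓡 m; F, E⟯
  frame_linearIndependent : ∀ x ∈ chart.source, LinearIndependent ℝ (fun a => frame a x)
  frame_span : ∀ x ∈ chart.source, Submodule.span ℝ (Set.range fun a => frame a x) = ⊤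
  /-- the constants `gᵃᵇ` -/
  gram : Matrix ι ι ℝ
  gram_eq : ∀ x ∈ chart.source, ∀ a b, 𝒞.pairing x (frame a x) (frame b x) = gram a b

namespace DarbouxChart

variable {𝒞 : CourantAlgebroid m M F E} {ι : Type}

/-- The domain of the coordinates `qⁱ`. -/
def dom (c : DarbouxChart 𝒞 ι) : TopologicalSpace.Opens (EuclideanSpace ℝ (Fin m)) :=
  ⟨c.chart.target, c.chart.open_target⟩

/-- The function `ρ(ξᵃ)qⁱ`, in the coordinates `q`. -/
def anchorFun (c : DarbouxChart 𝒞 ι) (a : ι) (i : Fin m) :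
    SmoothFun c.dom :=
  ⟨fun y => EuclideanSpace.proj (𝕜 := ℝ) i (mfderiv (𝓡 m) (𝓡 m) c.chart (c.chart.symm y)
      (𝒞.anchor (c.chart.symm y) (c.frame a (c.chart.symm y)))), by
    have hs := contMDiffOn_symm_of_mem_maximalAtlas c.chart_mem
    have ht := (contMDiffOn_of_mem_maximalAtlas c.chart_mem).contMDiffOn_tangentMapWithin
      (m := ∞) (by simp) c.chart.open_source.uniqueMDiffOn
    have hX := (𝒞.anchor_smooth (c.frame a)).comp_contMDiffOn hs
    have h1 := (contMDiff_snd_tangentBundle_modelSpace (EuclideanSpace ℝ (Fin m))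
      (𝓡 m) (n := ∞)).comp_contMDiffOn (ht.comp hX fun y hy => c.chart.map_target hy)
    have h2 := (EuclideanSpace.proj i : EuclideanSpace ℝ (Fin m) →L[ℝ] ℝ).contDiff.comp_contDiffOn
      (contMDiffOn_iff_contDiffOn.1 h1)
    refine h2.congr fun y hy => ?_
    have : mfderiv (𝓡 m) (𝓡 m) c.chart (c.chart.symm y) =
        mfderivWithin (𝓡 m) (𝓡 m) c.chart c.chart.source (c.chart.symm y) :=
      (mfderivWithin_of_isOpen c.chart.open_source (c.chart.map_target hy)).symm
    rw [this]
    rfl⟩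

/-- The function `⟨ξᵃ ∘ ξᵇ, ξᶜ⟩`, in the coordinates `q`. -/
def bracketFun (c : DarbouxChart 𝒞 ι) (a b d : ι) : SmoothFun c.dom :=
  ⟨fun y => 𝒞.pairing (c.chart.symm y)
      (𝒞.bracket (c.frame a) (c.frame b) (c.chart.symm y)) (c.frame d (c.chart.symm y)), by
    have h := (𝒞.pairing_smooth (𝒞.bracket (c.frame a) (c.frame b)) (c.frame d)).comp_contMDiffOn
      (contMDiffOn_symm_of_mem_maximalAtlas c.chart_mem)
    exact contMDiffOn_iff_contDiffOn.1 h⟩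

variable [Fintype ι] [DecidableEq ι]

/-- The coefficients `fₐⁱ`, determined by `∑ᵦ gᵃᵇ fᵦⁱ = ρ(ξᵃ)qⁱ`. -/
def coeffF (c : DarbouxChart 𝒞 ι) (a : ι) (i : Fin m) : SmoothFun c.dom :=
  ∑ b, c.gram⁻¹ a b • c.anchorFun b i

/-- The coefficients `hₐᵦ꜀`, determined by `∑ gᵃᵃ' gᵇᵇ' gᶜᶜ' hₐ'ᵦ'꜀' = ⟨ξᵃ ∘ ξᵇ, ξᶜ⟩`. -/
def coeffH (c : DarbouxChart 𝒞 ι) (a b d : ι) : SmoothFun c.dom :=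
  ∑ a', ∑ b', ∑ d',
    (c.gram⁻¹ a a' * c.gram⁻¹ b b' * c.gram⁻¹ d d') • c.bracketFun a' b' d'

/-- The cubic Hamiltonian `Θ = ∑ fₐⁱ ξᵃ pᵢ - ⅙ ∑ hₐᵦ꜀ ξᵃ ξᵇ ξᶜ` of the Courant algebroid. -/
def theta (c : DarbouxChart 𝒞 ι) : Multivector c.dom ι :=
  Multivector.cubic c.coeffF c.coeffH

/-- The blended homological vector field `Q = π + X_Θ`, where `X_Θ = ι_Θ π`. -/
def blendedQ (c : DarbouxChart 𝒞 ι) : Multivector c.dom ι :=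
  Multivector.poisson c.gram + Multivector.contract c.theta (Multivector.poisson c.gram)

/-- `Q|_{ℰ₋₁}` vanishes on the conormal bundle of `ℬ[1]` in `ℰ₋₁`, over the domain of the chart. -/
def IsCoisotropic (c : DarbouxChart 𝒞 ι) (A : ∀ x, Submodule ℝ (E x)) : Prop :=
  ∀ x ∈ c.chart.source, Multivector.VanishesOnConormal (fun a => c.frame a x)
    (dualSubbundle 𝒞 A x) (c.chart x) c.blendedQ

/-- A Darboux chart is adapted to `A` if the first half of its frame is a frame of `A` (so that the
other half is a frame of a complement of `A`). -/
def IsAdapted {n : ℕ} (c : DarbouxChart 𝒞 (Fin n ⊕ Fin n)) (A : ∀ x, Submodule ℝ (E x)) : Prop :=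
  ∀ x ∈ c.chart.source, A x = Submodule.span ℝ (Set.range fun j => c.frame (Sum.inl j) x)

end DarbouxChart

/-- `ℬ[1] ⊂ ℰ` is of coisotropic type with respect to `π + X_Θ`. The condition is local on `M`; the
identification of `ℰ` with the graded vector bundle `E*[1] ⊕ T*[2]M`, and with it the inclusions
`ℬ[1] ⊂ ℰ₋₁ ⊂ ℰ`, are those given by the Darboux charts adapted to `A` (other Darboux charts have
different loci `p = 0`). -/
def IsOfCoisotropicType (n : ℕ) (𝒞 : CourantAlgebroid m M F E)
    (A : ∀ x, Submodule ℝ (E x)) : Prop :=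
  ∀ x : M, ∃ c : DarbouxChart 𝒞 (Fin n ⊕ Fin n),
    x ∈ c.chart.source ∧ c.IsAdapted A ∧ c.IsCoisotropic A

end Darboux

end CourantDirac

end

/-! A covector `α` on `E*` at `x` is the vector `u = ∑ αₐ ξᵃ` of `E x`, and it annihilates `ℬ`
exactly when `u` lies in the orthogonal `A^⊥`. In `Q = π + X_Θ` the bivector is quadratic in the
`∂/∂ξᵃ` and `X_Θ` is linear in them, so only `l = 1` and `l = 2` carry information
(`Multivector.vanishesOnConormal_iff`). For `l = 2` the contraction is the constant `⟨u', u⟩`, so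
the condition says that `A^⊥` is isotropic; as `A` and `A^⊥` both have rank `n`, this means `A^⊥ =
A`. For `l = 1` it is the derivative of `Θ` along `gα`, restricted to `p = 0` and `ℬ`: a two-form on
`ℬ` whose coefficients come from `h`. On the basis `⟨ξᵏ,·⟩` of `ℬ` its vanishing is that of `⟨ξᵏ ∘
ξˡ, u⟩` (`DarbouxChart.sum_coeffH`). Thus in an adapted chart the condition reads `A^⊥ = A` and `⟨ξⁱ
∘ ξʲ, ξᵏ⟩ = 0` for the frame of `A` (`DarbouxChart.IsAdapted.vanishesOnConormal_iff`).

On an isotropic `A` the expression `⟨e₁ ∘ e₂, e₃⟩` is totally skew, since the derivative terms in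
the axioms vanish. It depends on `e₃` only through its value at the point, hence by skewness the
same is true of every argument. Vanishing on a frame therefore amounts to vanishing on all sections
of `A` (`pairing_bracket_eq_zero_of_spanning`), that is, to `e₁ ∘ e₂` being a section of `A^⊥ = A`.

To get a chart from a Dirac structure, a local frame of `A` is completed by a dual isotropic frame,
so that the Gram matrix is constant (`exists_adapted_chart`). Independence of the chart follows
because being Dirac does not mention charts. -/

open scoped Manifold ContDiff TensorProduct Bundle

noncomputable section

namespace CourantDirac

namespace Multivector

/-! ### Derivatives on the algebra of multivector fields -/

section Calculus

variable {m : ℕ} {Ω : TopologicalSpace.Opens (EuclideanSpace ℝ (Fin m))} {ι : Type}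

theorem mk_mul (f f' : SmoothFun Ω) (P P' : MvPolynomial (EvenGen m ι) ℝ)
    (η η' : ExteriorAlgebra ℝ (OddGen m ι →₀ ℝ)) :
    mk f P η * mk f' P' η' = mk (f * f') (P * P') (η * η') :=
  (Algebra.TensorProduct.tmul_mul_tmul f f' (P ⊗ₜ[ℝ] η) (P' ⊗ₜ[ℝ] η')).trans
    (congrArg (TensorProduct.tmul ℝ (f * f')) (Algebra.TensorProduct.tmul_mul_tmul P P' η η'))

theorem one_eq_mk : (1 : Multivector Ω ι) = mk 1 1 1 := rfl

/-- Reduces linear identities to products `f P η`, where each derivative acts on a single tensor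
factor. -/
theorem induction_mk {p : Multivector Ω ι → Prop} (x : Multivector Ω ι)
    (hmk : ∀ f P η, p (mk f P η)) (hadd : ∀ x y, p x → p y → p (x + y)) : p x := by
  have h0 : p 0 := by
    have h := hmk 0 0 0
    rwa [mk, TensorProduct.zero_tmul] at h
  refine TensorProduct.induction_on x h0 (fun f z => ?_) hadd
  refine TensorProduct.induction_on z ?_ (fun P η => hmk f P η) (fun a b ha hb => ?_)
  · rw [TensorProduct.tmul_zero]; exact h0
  · rw [TensorProduct.tmul_add]; exact hadd _ _ ha hb

theorem derivEven_mk (v : EvenGen m ι) (f : SmoothFun Ω) (P : MvPolynomial (EvenGen m ι) ℝ)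
    (η : ExteriorAlgebra ℝ (OddGen m ι →₀ ℝ)) :
    derivEven v (mk f P η) = mk f (MvPolynomial.pderiv v P) η := rfl

theorem derivOdd_mk (v : OddGen m ι) (f : SmoothFun Ω) (P : MvPolynomial (EvenGen m ι) ℝ)
    (η : ExteriorAlgebra ℝ (OddGen m ι →₀ ℝ)) :
    derivOdd v (mk f P η) = mk f P (CliffordAlgebra.contractRight η (Finsupp.lapply v)) := rfl

theorem mk_zero_middle (f : SmoothFun Ω) (η : ExteriorAlgebra ℝ (OddGen m ι →₀ ℝ)) :
    (mk f 0 η : Multivector Ω ι) = 0 := by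
  rw [mk, TensorProduct.zero_tmul, TensorProduct.tmul_zero]; rfl

theorem mk_zero_right (f : SmoothFun Ω) (P : MvPolynomial (EvenGen m ι) ℝ) :
    (mk f P 0 : Multivector Ω ι) = 0 := by
  rw [mk, TensorProduct.tmul_zero, TensorProduct.tmul_zero]; rfl

theorem mk_add_middle (f : SmoothFun Ω) (P P' : MvPolynomial (EvenGen m ι) ℝ)
    (η : ExteriorAlgebra ℝ (OddGen m ι →₀ ℝ)) :
    (mk f (P + P') η : Multivector Ω ι) = mk f P η + mk f P' η := by
  rw [mk, TensorProduct.add_tmul, TensorProduct.tmul_add]; rfl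

/-- The derivative with respect to an even generator is a derivation. -/
theorem derivEven_mul (v : EvenGen m ι) (x y : Multivector Ω ι) :
    derivEven v (x * y) = derivEven v x * y + x * derivEven v y := by
  induction x using induction_mk with
  | hadd x x' hx hx' => rw [add_mul, map_add, hx, hx', map_add, add_mul, add_mul]; abel
  | hmk f P η =>
    induction y using induction_mk with
    | hadd y y' hy hy' => rw [mul_add, map_add, hy, hy', map_add, mul_add, mul_add]; abel
    | hmk f' P' η' =>
      simp only [mk_mul, derivEven_mk, Derivation.leibniz, smul_eq_mul, ← mk_add_middle]
      rw [add_comm, mul_comm P']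

theorem derivEven_derivQ (v : EvenGen m ι) (i : Fin m) (x : Multivector Ω ι) :
    derivEven v (derivQ i x) = derivQ i (derivEven v x) := by
  induction x using induction_mk with
  | hadd x x' hx hx' => simp only [map_add, hx, hx']
  | hmk f P η => rfl

theorem derivEven_derivOdd (v : EvenGen m ι) (w : OddGen m ι) (x : Multivector Ω ι) :
    derivEven v (derivOdd w x) = derivOdd w (derivEven v x) := by
  induction x using induction_mk with
  | hadd x x' hx hx' => simp only [map_add, hx, hx']
  | hmk f P η => rfl

/-- The commutator of two derivations is a derivation, and this one kills every variable. -/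
theorem pderiv_comm {σ : Type*} (v w : σ) (P : MvPolynomial σ ℝ) :
    MvPolynomial.pderiv v (MvPolynomial.pderiv w P) =
      MvPolynomial.pderiv w (MvPolynomial.pderiv v P) := by
  classical
  have h : ⁅MvPolynomial.pderiv (R := ℝ) v, MvPolynomial.pderiv (R := ℝ) w⁆ = 0 := by
    refine MvPolynomial.derivation_ext fun u => ?_
    rw [Derivation.commutator_apply, MvPolynomial.pderiv_X, MvPolynomial.pderiv_X,
      Derivation.zero_apply, Pi.single_apply, Pi.single_apply]
    split_ifs <;> simp
  have := congrArg (fun D : Derivation ℝ (MvPolynomial σ ℝ) (MvPolynomial σ ℝ) => D P) h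
  simpa [Derivation.commutator_apply, sub_eq_zero] using this

theorem derivEven_derivEven (v w : EvenGen m ι) (x : Multivector Ω ι) :
    derivEven v (derivEven w x) = derivEven w (derivEven v x) := by
  induction x using induction_mk with
  | hadd x x' hx hx' => simp only [map_add, hx, hx']
  | hmk f P η => simp only [derivEven_mk, pderiv_comm v w]

theorem derivEven_odd (v : EvenGen m ι) (w : OddGen m ι) :
    derivEven v (odd w : Multivector Ω ι) = 0 := by
  rw [odd, derivEven_mk, Derivation.map_one_eq_zero, mk_zero_middle]

theorem derivEven_ofFun (v : EvenGen m ι) (f : SmoothFun Ω) :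
    derivEven v (ofFun f : Multivector Ω ι) = 0 := by
  rw [ofFun, derivEven_mk, Derivation.map_one_eq_zero, mk_zero_middle]

theorem derivEven_dxi_p (a : ι) (i : Fin m) :
    derivEven (.dxi a) (even (.p i) : Multivector Ω ι) = 0 := by
  rw [even, derivEven_mk, MvPolynomial.pderiv_X_of_ne (by simp), mk_zero_middle]

theorem derivEven_dxi_dxi [DecidableEq ι] (a b : ι) :
    derivEven (.dxi a) (even (.dxi b) : Multivector Ω ι) = if a = b then 1 else 0 := by
  rw [even, derivEven_mk]
  split_ifs with h
  · subst h; rw [MvPolynomial.pderiv_X_self]; rfl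
  · rw [MvPolynomial.pderiv_X_of_ne (by simpa using Ne.symm h), mk_zero_middle]

theorem derivOdd_even (w : OddGen m ι) (v : EvenGen m ι) :
    derivOdd w (even v : Multivector Ω ι) = 0 := by
  rw [even, derivOdd_mk, CliffordAlgebra.contractRight_one, mk_zero_right]

theorem mk_smul_right (c : ℝ) (f : SmoothFun Ω) (P : MvPolynomial (EvenGen m ι) ℝ)
    (η : ExteriorAlgebra ℝ (OddGen m ι →₀ ℝ)) :
    (mk f P (c • η) : Multivector Ω ι) = c • mk f P η := by
  rw [mk, TensorProduct.tmul_smul, TensorProduct.tmul_smul]; rfl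

theorem mk_sub_right (f : SmoothFun Ω) (P : MvPolynomial (EvenGen m ι) ℝ)
    (η η' : ExteriorAlgebra ℝ (OddGen m ι →₀ ℝ)) :
    (mk f P (η - η') : Multivector Ω ι) = mk f P η - mk f P η' := by
  rw [mk, TensorProduct.tmul_sub, TensorProduct.tmul_sub]; rfl

/-- This special case replaces the graded Leibniz rule: the odd monomials of `π` and `Θ` are built
by multiplying by one odd generator at a time on the right. -/
theorem derivOdd_mul_odd (w b : OddGen m ι) [Decidable (b = w)] (x : Multivector Ω ι) :
    derivOdd w (x * odd b) = (if b = w then x else 0) - derivOdd w x * odd b := by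
  classical
  induction x using induction_mk with
  | hadd x x' hx hx' => rw [add_mul, map_add, hx, hx', map_add, add_mul]; split_ifs <;> abel
  | hmk f P η =>
    rw [odd, mk_mul, derivOdd_mk, derivOdd_mk, mk_mul, ExteriorAlgebra.ι,
      CliffordAlgebra.contractRight_mul_ι, mk_sub_right, mk_smul_right, Finsupp.lapply_apply,
      Finsupp.single_apply, ite_smul, one_smul, zero_smul, mul_one, mul_one]

theorem derivOdd_mul_even (w : OddGen m ι) (u : EvenGen m ι) (x : Multivector Ω ι) :
    derivOdd w (x * even u) = derivOdd w x * even u := by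
  induction x using induction_mk with
  | hadd x x' hx hx' => rw [add_mul, map_add, hx, hx', map_add, add_mul]
  | hmk f P η => simp only [even, mk_mul, derivOdd_mk, mul_one]

theorem derivOdd_ofFun_mul (w : OddGen m ι) (f : SmoothFun Ω) (x : Multivector Ω ι) :
    derivOdd w (ofFun f * x) = ofFun f * derivOdd w x := by
  induction x using induction_mk with
  | hadd x x' hx hx' => rw [mul_add, map_add, hx, hx', map_add, mul_add]
  | hmk f' P η => simp only [ofFun, mk_mul, derivOdd_mk, one_mul]

theorem derivOdd_odd (w b : OddGen m ι) [Decidable (b = w)] :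
    derivOdd w (odd b : Multivector Ω ι) = if b = w then 1 else 0 := by
  have h : derivOdd w (1 : Multivector Ω ι) = 0 := by
    rw [one_eq_mk, derivOdd_mk, CliffordAlgebra.contractRight_one, mk_zero_right]
  rw [← one_mul (odd b), derivOdd_mul_odd, h, zero_mul, sub_zero]

end Calculus

/-! ### Restriction to the fibre of `ℬ[1]` -/

section Restriction

variable {m : ℕ} {Ω : TopologicalSpace.Opens (EuclideanSpace ℝ (Fin m))} {ι : Type}
  {V : Type*} [AddCommGroup V] [Module ℝ V] (v : ι → V)
  (W : Submodule ℝ (Module.Dual ℝ V)) (y : EuclideanSpace ℝ (Fin m))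

/-- The restriction to the subspace `W` of the linear coordinate `ξᵃ`. -/
def restrictedCoord (a : ι) : Module.Dual ℝ W := (Module.Dual.eval ℝ V (v a)).comp W.subtype

theorem restrict_mk (f : SmoothFun Ω) (P : MvPolynomial (EvenGen m ι) ℝ)
    (η : ExteriorAlgebra ℝ (OddGen m ι →₀ ℝ)) :
    restrict v W y (mk f P η) = f.1 y • MvPolynomial.aeval (fun _ => (0 : ℝ)) P •
      ExteriorAlgebra.map (Finsupp.linearCombination ℝ fun w : OddGen m ι => match w with
      | .xi a => (Module.Dual.eval ℝ V (v a)).comp W.subtype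
      | .dq _ => 0
      | .dp _ => 0) η := rfl

theorem restrict_even (w : EvenGen m ι) : restrict v W y (even w : Multivector Ω ι) = 0 := by
  rw [even, restrict_mk, MvPolynomial.aeval_X, zero_smul, smul_zero]

theorem restrict_odd_xi (a : ι) : restrict v W y (odd (.xi a) : Multivector Ω ι) =
    ExteriorAlgebra.ι ℝ (restrictedCoord v W a) := by
  rw [odd, restrict_mk, map_one, one_smul, ExteriorAlgebra.map_apply_ι,
    Finsupp.linearCombination_single, one_smul]
  exact one_smul _ _

theorem restrict_odd_dq (i : Fin m) : restrict v W y (odd (.dq i) : Multivector Ω ι) = 0 := by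
  rw [odd, restrict_mk, ExteriorAlgebra.map_apply_ι, Finsupp.linearCombination_single, smul_zero,
    map_zero, smul_zero, smul_zero]

theorem restrict_odd_dp (i : Fin m) : restrict v W y (odd (.dp i) : Multivector Ω ι) = 0 := by
  rw [odd, restrict_mk, ExteriorAlgebra.map_apply_ι, Finsupp.linearCombination_single, smul_zero,
    map_zero, smul_zero, smul_zero]

theorem restrict_ofFun (f : SmoothFun Ω) :
    restrict v W y (ofFun f : Multivector Ω ι) = algebraMap ℝ _ (f.1 y) := by
  rw [ofFun, restrict_mk, map_one, map_one, one_smul, Algebra.algebraMap_eq_smul_one]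

end Restriction

/-! ### Contractions of `π + X_Θ` with conormal covectors -/

section Contraction

variable {m : ℕ} {Ω : TopologicalSpace.Opens (EuclideanSpace ℝ (Fin m))} {ι : Type} [Fintype ι]

theorem contractCovector_add (α : ι → ℝ) (x y : Multivector Ω ι) :
    contractCovector α (x + y) = contractCovector α x + contractCovector α y := by
  simp only [contractCovector, map_add, smul_add, Finset.sum_add_distrib]

theorem contractCovector_zero (α : ι → ℝ) : contractCovector α (0 : Multivector Ω ι) = 0 := by
  simp only [contractCovector, map_zero, smul_zero, Finset.sum_const_zero]

/-- The Leibniz rule yields two sums that agree by symmetry of `g`, which cancels the factor `½`. -/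
theorem derivEven_dxi_poisson {g : Matrix ι ι ℝ} (hg : g.IsSymm) (a : ι) :
    derivEven (.dxi a) (poisson g : Multivector Ω ι) = ∑ b, g a b • even (.dxi b) := by
  classical
  have hs : ∑ b, g b a • (even (.dxi b) : Multivector Ω ι) = ∑ b, g a b • even (.dxi b) :=
    Finset.sum_congr rfl fun b _ => by rw [hg.apply]
  have h2 : ∀ x : Multivector Ω ι, (1 / 2 : ℝ) • (x + x) = x := fun x => by
    rw [← two_smul ℝ x, smul_smul]; norm_num
  simp only [poisson, map_add, map_sum, derivEven_mul, derivEven_odd, map_smul,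
    derivEven_dxi_dxi, zero_mul, mul_zero, add_zero, Finset.sum_const_zero, zero_add, ite_mul,
    mul_ite, one_mul, mul_one, smul_add, Finset.sum_add_distrib, smul_ite, smul_zero,
    Finset.sum_ite_irrel, Finset.sum_ite_eq, Finset.mem_univ, if_true]
  rw [← smul_add, hs, h2]

theorem contractCovector_poisson {g : Matrix ι ι ℝ} (hg : g.IsSymm) (α : ι → ℝ) :
    contractCovector α (poisson g : Multivector Ω ι) = ∑ a, g.mulVec α a • even (.dxi a) := by
  simp only [contractCovector, derivEven_dxi_poisson hg, Finset.smul_sum, smul_smul]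
  rw [Finset.sum_comm]
  refine Finset.sum_congr rfl fun b _ => ?_
  rw [← Finset.sum_smul]
  congr 1
  exact Finset.sum_congr rfl fun a _ => by rw [mul_comm, hg.apply]

theorem derivEven_dxi_cubic (f : ι → Fin m → SmoothFun Ω) (h : ι → ι → ι → SmoothFun Ω) (a : ι) :
    derivEven (.dxi a) (cubic f h) = 0 := by
  simp only [cubic, map_sub, map_sum, map_smul, derivEven_mul, derivEven_odd, derivEven_ofFun,
    derivEven_dxi_p, zero_mul, mul_zero, add_zero, Finset.sum_const_zero, smul_zero, sub_zero]

/-- Since `Θ` contains no `∂/∂ξ`, the derivative falls on the factor coming from `π`. The `∂/∂q` and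
`∂/∂p` terms then drop out, as odd derivatives kill `∂/∂ξ`. -/
theorem contractCovector_contract_poisson {g : Matrix ι ι ℝ} (hg : g.IsSymm) (α : ι → ℝ)
    {Θ : Multivector Ω ι} (hΘ : ∀ a, derivEven (.dxi a) Θ = 0) :
    contractCovector α (contract Θ (poisson g)) = ∑ a, g.mulVec α a • derivOdd (.xi a) Θ := by
  classical
  have key : ∀ a, derivEven (.dxi a) (contract Θ (poisson g)) =
      ∑ b, g a b • derivOdd (.xi b) Θ := fun a => by
    simp only [contract, map_add, map_sum, derivEven_mul, derivEven_derivQ, derivEven_derivOdd,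
      derivEven_derivEven (.dxi a) (.p _), hΘ, map_zero, zero_mul, zero_add,
      derivEven_dxi_poisson hg, map_smul, derivOdd_even, smul_zero, Finset.sum_const_zero,
      mul_zero, derivEven_dxi_dxi, smul_ite, Finset.sum_ite_eq, Finset.mem_univ, if_true,
      mul_smul_comm, mul_one]
    exact Finset.sum_congr rfl fun b _ => by rw [hg.apply]
  simp only [contractCovector, key, Finset.smul_sum, smul_smul]
  rw [Finset.sum_comm]
  refine Finset.sum_congr rfl fun b _ => ?_
  rw [← Finset.sum_smul]
  congr 1
  exact Finset.sum_congr rfl fun a _ => by rw [mul_comm, hg.apply]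

/-- One contraction already exhausts the `∂/∂ξ` in `X_Θ`, so only the quadratic part of `π` survives
the second. For a Gram matrix the result is the pairing of the two vectors. -/
theorem contractCovector_contractCovector {g : Matrix ι ι ℝ} (hg : g.IsSymm) (α α' : ι → ℝ)
    {Θ : Multivector Ω ι} (hΘ : ∀ a, derivEven (.dxi a) Θ = 0) :
    contractCovector α' (contractCovector α (poisson g + contract Θ (poisson g))) =
      (α' ⬝ᵥ g.mulVec α) • 1 := by
  classical
  rw [contractCovector_add, contractCovector_poisson hg, contractCovector_contract_poisson hg _ hΘ,
    contractCovector_add]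
  simp only [contractCovector, map_sum, map_smul, derivEven_derivOdd, hΘ, map_zero, smul_zero,
    Finset.sum_const_zero, add_zero, derivEven_dxi_dxi, smul_ite, Finset.sum_ite_eq,
    Finset.mem_univ, if_true, smul_smul, dotProduct, Finset.sum_smul]

variable {V : Type*} [AddCommGroup V] [Module ℝ V] (v : ι → V)
  (W : Submodule ℝ (Module.Dual ℝ V)) (y : EuclideanSpace ℝ (Fin m))

theorem restrict_derivOdd_dq_poisson (g : Matrix ι ι ℝ) (i : Fin m) :
    restrict v W y (derivOdd (.dq i) (poisson g : Multivector Ω ι)) = 0 := by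
  classical
  simp only [poisson, map_add, map_sum, map_smul, derivOdd_mul_even, derivOdd_even, zero_mul,
    smul_zero, Finset.sum_const_zero, add_zero, derivOdd_mul_odd, map_sub, map_mul,
    restrict_odd_dp, mul_zero, sub_zero, reduceCtorEq, if_false, map_zero]

theorem restrict_derivOdd_dp_poisson (g : Matrix ι ι ℝ) (i : Fin m) :
    restrict v W y (derivOdd (.dp i) (poisson g : Multivector Ω ι)) = 0 := by
  classical
  simp only [poisson, map_add, map_sum, map_smul, derivOdd_mul_even, derivOdd_even, zero_mul,
    smul_zero, Finset.sum_const_zero, add_zero, derivOdd_mul_odd, map_sub, map_mul,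
    restrict_odd_dp, mul_zero, sub_zero, apply_ite (restrict v W y), restrict_odd_dq, ite_self,
    map_zero]

theorem restrict_poisson_add_contract {g : Matrix ι ι ℝ} (hg : g.IsSymm) (Θ : Multivector Ω ι) :
    restrict v W y (poisson g + contract Θ (poisson g)) = 0 := by
  have h : restrict v W y (poisson g : Multivector Ω ι) = 0 := by
    simp only [poisson, map_add, map_sum, map_smul, map_mul, restrict_even, restrict_odd_dp,
      mul_zero, smul_zero, Finset.sum_const_zero, add_zero]
  simp only [map_add, h, contract, map_sum, map_mul, restrict_derivOdd_dq_poisson,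
    restrict_derivOdd_dp_poisson, derivEven_dxi_poisson hg, map_smul, restrict_even, mul_zero,
    smul_zero, Finset.sum_const_zero, add_zero]

/-- The terms with `f` carry a factor `pᵢ` and disappear at `p = 0`; the anchor plays no further
role. -/
theorem restrict_derivOdd_xi_cubic [DecidableEq ι] (f : ι → Fin m → SmoothFun Ω)
    (h : ι → ι → ι → SmoothFun Ω) (e : ι) :
    restrict v W y (derivOdd (.xi e) (cubic f h)) = -((1 / 6 : ℝ) • ∑ a, ∑ b, ∑ d, (h a b d).1 y •
      ((if d = e then ExteriorAlgebra.ι ℝ (restrictedCoord v W a) *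
          ExteriorAlgebra.ι ℝ (restrictedCoord v W b) else 0) -
        ((if b = e then ExteriorAlgebra.ι ℝ (restrictedCoord v W a) else 0) -
          (if a = e then 1 else 0) * ExteriorAlgebra.ι ℝ (restrictedCoord v W b)) *
          ExteriorAlgebra.ι ℝ (restrictedCoord v W d))) := by
  classical
  simp only [cubic, map_sub, map_sum, map_smul, derivOdd_mul_even, derivOdd_ofFun_mul,
    derivOdd_mul_odd, derivOdd_odd, map_mul, restrict_even, mul_zero, Finset.sum_const_zero,
    zero_sub, restrict_ofFun, restrict_odd_xi, apply_ite (restrict v W y), map_zero, map_one,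
    OddGen.xi.injEq, ← Algebra.smul_def]

/-- The restriction to `W` of the contraction with a covector of the Hamiltonian vector field of a
cubic function with totally antisymmetric coefficients. -/
theorem restrict_sum_derivOdd_cubic (f : ι → Fin m → SmoothFun Ω)
    (h : ι → ι → ι → SmoothFun Ω) (h12 : ∀ a b d, (h a b d).1 y = -(h b a d).1 y)
    (h23 : ∀ a b d, (h a b d).1 y = -(h a d b).1 y) (γ : ι → ℝ) :
    restrict v W y (∑ e, γ e • derivOdd (.xi e) (cubic f h)) =
      -((1 / 2 : ℝ) • ∑ b, ∑ d, (∑ a, γ a * (h a b d).1 y) •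
        (ExteriorAlgebra.ι ℝ (restrictedCoord v W b) *
          ExteriorAlgebra.ι ℝ (restrictedCoord v W d))) := by
  classical
  set φ : ι → ExteriorAlgebra ℝ (Module.Dual ℝ W) :=
    fun a => ExteriorAlgebra.ι ℝ (restrictedCoord v W a) with hφ
  set S := ∑ b, ∑ d, (∑ a, γ a * (h a b d).1 y) • (φ b * φ d) with hS
  have hS' : S = ∑ a, ∑ b, ∑ d, ((h a b d).1 y * γ a) • (φ b * φ d) := by
    simp only [hS, Finset.sum_smul, mul_comm (γ _)]
    exact (Finset.sum_comm.trans (Finset.sum_congr rfl fun b _ => Finset.sum_comm)).symm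
  -- Moving `γ` from the last slot of `h` to the first takes two transpositions, from the middle
  -- slot one. With their signs the three terms are equal, so `⅙` becomes `½`.
  have e1 : ∑ a, ∑ b, ∑ d, ((h a b d).1 y * γ d) • (φ a * φ b) = S := by
    simp only [hS, Finset.sum_smul]
    refine Finset.sum_congr rfl fun b _ => Finset.sum_congr rfl fun d _ =>
      Finset.sum_congr rfl fun a _ => ?_
    rw [mul_comm, h12 a b d, h23 b a d, neg_neg]
  have e2 : ∑ a, ∑ b, ∑ d, ((h a b d).1 y * γ b) • (φ a * φ d) = -S := by
    simp only [hS, Finset.sum_smul, ← Finset.sum_neg_distrib]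
    refine Finset.sum_congr rfl fun b _ => Finset.sum_comm.trans <|
      Finset.sum_congr rfl fun d _ => Finset.sum_congr rfl fun a _ => ?_
    rw [mul_comm, h12 a b d, mul_neg, neg_smul, neg_neg]
  have key : restrict v W y (∑ e, γ e • derivOdd (.xi e) (cubic f h)) =
      -((1 / 6 : ℝ) • ∑ a, ∑ b, ∑ d, (((h a b d).1 y * γ d) • (φ a * φ b) -
        ((h a b d).1 y * γ b) • (φ a * φ d) + ((h a b d).1 y * γ a) • (φ b * φ d))) := by
    simp only [map_sum, map_smul, restrict_derivOdd_xi_cubic, smul_neg, Finset.sum_neg_distrib,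
      smul_comm (γ _) (1 / 6 : ℝ), ← Finset.smul_sum]
    congr 2
    simp only [Finset.smul_sum]
    rw [Finset.sum_comm]
    refine Finset.sum_congr rfl fun a _ => ?_
    rw [Finset.sum_comm]
    refine Finset.sum_congr rfl fun b _ => ?_
    rw [Finset.sum_comm]
    refine Finset.sum_congr rfl fun d _ => ?_
    simp only [sub_mul, ite_mul, zero_mul, one_mul, smul_sub, Finset.sum_sub_distrib, smul_ite,
      smul_zero, Finset.sum_ite_eq, Finset.mem_univ, if_true, smul_smul, mul_comm (γ _), hφ]
    abel
  rw [key]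
  simp only [Finset.sum_add_distrib, Finset.sum_sub_distrib, e1, e2, ← hS']
  module

/-- The vanishing on the conormal directions only involves contractions with at most two
covectors. -/
theorem vanishesOnConormal_iff {g : Matrix ι ι ℝ} (hg : g.IsSymm) {Θ : Multivector Ω ι}
    (hΘ : ∀ a, derivEven (.dxi a) Θ = 0) :
    VanishesOnConormal v W y (poisson g + contract Θ (poisson g)) ↔
      (∀ α : ι → ℝ, (∀ β ∈ W, β (∑ a, α a • v a) = 0) →
        restrict v W y (∑ a, g.mulVec α a • derivOdd (.xi a) Θ) = 0) ∧
      (∀ α α' : ι → ℝ, (∀ β ∈ W, β (∑ a, α a • v a) = 0) →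
        (∀ β ∈ W, β (∑ a, α' a • v a) = 0) → α' ⬝ᵥ g.mulVec α = 0) := by
  have h1 : ∀ α : ι → ℝ, restrict v W y
      (contractCovector α (poisson g + contract Θ (poisson g))) =
        restrict v W y (∑ a, g.mulVec α a • derivOdd (.xi a) Θ) := fun α => by
    rw [contractCovector_add, contractCovector_poisson hg,
      contractCovector_contract_poisson hg _ hΘ, map_add]
    simp only [map_sum, map_smul, restrict_even, smul_zero, Finset.sum_const_zero, zero_add]
  constructor
  · refine fun H => ⟨fun α hα => ?_, fun α α' hα hα' => ?_⟩
    · rw [← h1]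
      exact H [α] (List.forall_mem_singleton.2 hα)
    · have := H [α', α] (List.forall_mem_cons.2 ⟨hα', List.forall_mem_singleton.2 hα⟩)
      simp only [List.foldr_cons, List.foldr_nil] at this
      rw [contractCovector_contractCovector hg _ _ hΘ, map_smul, map_one] at this
      simpa using this
  · rintro ⟨H1, H2⟩ αs hαs
    -- `foldr` applies the end of the list first, so the last two covectors are split off. Their
    -- contraction is already zero, and further ones keep it zero.
    rcases αs.eq_nil_or_concat with rfl | ⟨l, α, rfl⟩
    · exact restrict_poisson_add_contract v W y hg Θ
    rcases l.eq_nil_or_concat with rfl | ⟨l, α', rfl⟩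
    · refine (h1 α).trans (H1 α (hαs α (by simp)))
    · have h0 : ∀ l : List (ι → ℝ), l.foldr contractCovector (0 : Multivector Ω ι) = 0 :=
        fun l => by
          induction l with
          | nil => rfl
          | cons a l ih => rw [List.foldr_cons, ih, contractCovector_zero]
      simp only [List.concat_eq_append, List.foldr_append, List.foldr_cons, List.foldr_nil]
      rw [contractCovector_contractCovector hg _ _ hΘ,
        H2 α α' (hαs α (by simp)) (hαs α' (by simp)), zero_smul, h0, map_zero]

end Contraction

end Multivector

/-! ### Exterior algebra and index calculus -/

section Exterior

open CliffordAlgebra in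
/-- Double contraction of a decomposable element of degree two. -/
theorem contractLeft_contractLeft_ι_mul_ι {W : Type*} [AddCommGroup W] [Module ℝ W]
    (d d' : Module.Dual ℝ W) (φ ψ : W) :
    contractLeft (Q := (0 : QuadraticForm ℝ W)) d'
      (contractLeft d (ExteriorAlgebra.ι ℝ φ * ExteriorAlgebra.ι ℝ ψ)) =
      algebraMap ℝ (ExteriorAlgebra ℝ W) (d φ * d' ψ - d ψ * d' φ) := by
  rw [ExteriorAlgebra.ι, contractLeft_ι_mul, contractLeft_ι, map_sub, map_smul, contractLeft_ι,
    contractLeft_mul_algebraMap, contractLeft_ι, map_sub, map_mul, map_mul, Algebra.smul_def,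
    ← map_mul _ (d' φ), mul_comm (d' φ), map_mul]

variable {W : Type*} [AddCommMonoid W] [Module ℝ W] {ι : Type*} [Fintype ι]

/-- Contracting the two-form with evaluation at `u` and then at `w` gives a scalar, which by
skewness of `C` is twice the sum sought. -/
theorem sum_eq_zero_of_exterior_eq_zero {φ : ι → Module.Dual ℝ W} {C : ι → ι → ℝ}
    (hC : ∀ b d, C b d = -C d b)
    (h : ∑ b, ∑ d, C b d • (ExteriorAlgebra.ι ℝ (φ b) * ExteriorAlgebra.ι ℝ (φ d)) = 0) (u w : W) :
    ∑ b, ∑ d, C b d * (φ b u * φ d w) = 0 := by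
  have h' := congrArg (fun z => CliffordAlgebra.contractLeft (Q := (0 : QuadraticForm ℝ _))
    (Module.Dual.eval ℝ W w)
      (CliffordAlgebra.contractLeft (Module.Dual.eval ℝ W u) z)) h
  simp only [map_sum, map_smul, contractLeft_contractLeft_ι_mul_ι, map_zero] at h'
  simp only [Algebra.smul_def, ← map_mul, ← map_sum] at h'
  have h'' := (ExteriorAlgebra.algebraMap_leftInverse (R := ℝ) (Module.Dual ℝ W)).injective
    (h'.trans (map_zero _).symm)
  simp only [Module.Dual.eval_apply, mul_sub, Finset.sum_sub_distrib] at h''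
  have hswap : ∑ b, ∑ d, C b d * (φ d u * φ b w) = -∑ b, ∑ d, C b d * (φ b u * φ d w) := by
    rw [Finset.sum_comm]
    simp only [← Finset.sum_neg_distrib]
    refine Finset.sum_congr rfl fun b _ => Finset.sum_congr rfl fun d _ => ?_
    rw [hC d b, neg_mul]
  rw [hswap] at h''
  linarith

theorem exterior_eq_zero_of_sum_eq_zero {κ : Type*} [Fintype κ] (w : Module.Basis κ ℝ W)
    {φ : ι → Module.Dual ℝ W} {C : ι → ι → ℝ}
    (h : ∀ k l, ∑ b, ∑ d, C b d * (φ b (w k) * φ d (w l)) = 0) :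
    ∑ b, ∑ d, C b d • (ExteriorAlgebra.ι ℝ (φ b) * ExteriorAlgebra.ι ℝ (φ d)) = 0 := by
  have hφ : ∀ b, ExteriorAlgebra.ι ℝ (φ b) = ∑ k, φ b (w k) • ExteriorAlgebra.ι ℝ (w.coord k) :=
    fun b => by
      conv_lhs => rw [← w.sum_dual_apply_smul_coord (φ b)]
      simp only [map_sum, map_smul]
  have : ∑ b, ∑ d, C b d • (ExteriorAlgebra.ι ℝ (φ b) * ExteriorAlgebra.ι ℝ (φ d)) =
      ∑ k, ∑ l, (∑ b, ∑ d, C b d * (φ b (w k) * φ d (w l))) •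
        (ExteriorAlgebra.ι ℝ (w.coord k) * ExteriorAlgebra.ι ℝ (w.coord l)) := by
    simp only [hφ, Finset.sum_mul_sum, Finset.smul_sum, Finset.sum_smul, smul_mul_smul_comm,
      smul_smul]
    calc _ = ∑ b, ∑ k, ∑ d, ∑ l, (C b d * (φ b (w k) * φ d (w l))) •
          (ExteriorAlgebra.ι ℝ (w.coord k) * ExteriorAlgebra.ι ℝ (w.coord l)) :=
        Finset.sum_congr rfl fun b _ => Finset.sum_comm
      _ = ∑ k, ∑ b, ∑ l, ∑ d, (C b d * (φ b (w k) * φ d (w l))) •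
          (ExteriorAlgebra.ι ℝ (w.coord k) * ExteriorAlgebra.ι ℝ (w.coord l)) := by
        rw [Finset.sum_comm]
        exact Finset.sum_congr rfl fun k _ => Finset.sum_congr rfl fun b _ => Finset.sum_comm
      _ = _ := Finset.sum_congr rfl fun k _ => Finset.sum_comm
  rw [this]
  simp only [h, zero_smul, Finset.sum_const_zero]

variable [DecidableEq ι]

/-- Raising an index by `g` undoes lowering it by `G`; `sum_contract_lowered` uses this once in each
of the three slots. -/
theorem sum_vecMul_mul_inv {g G : Matrix ι ι ℝ} (hG : g * G = 1) (u X : ι → ℝ) :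
    ∑ a, Matrix.vecMul u g a * ∑ a', G a a' * X a' = ∑ a, u a * X a := by
  change Matrix.vecMul u g ⬝ᵥ G.mulVec X = u ⬝ᵥ X
  rw [← Matrix.dotProduct_mulVec, Matrix.mulVec_mulVec, hG, Matrix.one_mulVec]

/-- Contracting a tensor with indices lowered by `G` against vectors whose indices are raised by
the inverse of `G`. -/
theorem sum_contract_lowered {g G : Matrix ι ι ℝ} (hG : g * G = 1) (B : ι → ι → ι → ℝ)
    (u v w : ι → ℝ) :
    ∑ b, ∑ d, (∑ a, Matrix.vecMul u g a *
        ∑ a', ∑ b', ∑ d', G a a' * G b b' * G d d' * B a' b' d') *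
          (Matrix.vecMul v g b * Matrix.vecMul w g d) =
      ∑ a, ∑ b, ∑ d, u a * (v b * (w d * B a b d)) := by
  have h1 : ∀ b d, ∑ a, Matrix.vecMul u g a *
        ∑ a', ∑ b', ∑ d', G a a' * G b b' * G d d' * B a' b' d' =
      ∑ b', G b b' * ∑ d', G d d' * ∑ a, u a * B a b' d' := fun b d => by
    have := sum_vecMul_mul_inv hG u fun a' => ∑ b', ∑ d', G b b' * G d d' * B a' b' d'
    simp only [Finset.mul_sum] at this ⊢
    simp only [mul_assoc] at this ⊢
    rw [this, Finset.sum_comm]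
    refine Finset.sum_congr rfl fun b' _ => ?_
    rw [Finset.sum_comm]
    refine Finset.sum_congr rfl fun d' _ => Finset.sum_congr rfl fun a _ => ?_
    ring
  simp only [h1]
  have h2 : ∀ d, ∑ b, (∑ b', G b b' * ∑ d', G d d' * ∑ a, u a * B a b' d') *
      (Matrix.vecMul v g b * Matrix.vecMul w g d) =
      Matrix.vecMul w g d * ∑ d', G d d' * ∑ b, v b * ∑ a, u a * B a b d' := fun d => by
    have := sum_vecMul_mul_inv hG v fun b' => ∑ d', G d d' * ∑ a, u a * B a b' d'
    calc
      _ = Matrix.vecMul w g d * ∑ b, Matrix.vecMul v g b *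
          ∑ b', G b b' * ∑ d', G d d' * ∑ a, u a * B a b' d' := by
        rw [Finset.mul_sum]
        exact Finset.sum_congr rfl fun b _ => by ring
      _ = _ := by
        rw [this]
        congr 1
        simp only [Finset.mul_sum]
        rw [Finset.sum_comm]
        refine Finset.sum_congr rfl fun d' _ => Finset.sum_congr rfl fun b _ =>
          Finset.sum_congr rfl fun a _ => ?_
        ring
  rw [Finset.sum_comm]
  simp only [h2]
  rw [sum_vecMul_mul_inv hG w fun d' => ∑ b, v b * ∑ a, u a * B a b d']
  simp only [Finset.mul_sum]
  rw [Finset.sum_comm]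
  calc _ = ∑ b, ∑ a, ∑ d, w d * (v b * (u a * B a b d)) :=
        Finset.sum_congr rfl fun b _ => Finset.sum_comm
    _ = _ := by
      rw [Finset.sum_comm]
      refine Finset.sum_congr rfl fun a _ => Finset.sum_congr rfl fun b _ =>
        Finset.sum_congr rfl fun d _ => ?_
      ring

end Exterior

/-! ### The bracket on isotropic families -/

section Bracket

variable {m : ℕ} {M : Type*} [TopologicalSpace M] [ChartedSpace (EuclideanSpace ℝ (Fin m)) M]
  [IsManifold (𝓡 m) ∞ M]
  {F : Type*} [NormedAddCommGroup F] [NormedSpace ℝ F]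
  {E : M → Type*} [TopologicalSpace (Bundle.TotalSpace F E)]
  [∀ x, AddCommGroup (E x)] [∀ x, Module ℝ (E x)] [∀ x, TopologicalSpace (E x)]
  [FiberBundle F E] [VectorBundle ℝ F E] (𝒞 : CourantAlgebroid m M F E)

open Topology

variable {𝒞} in
-- A locally constant pairing covers both uses: Darboux frames (`r = gᵃᵇ`) and sections of an
-- isotropic family (`r = 0`). It makes the bracket skew under the two swaps below.
theorem mfderiv_pairing_eq_zero {x : M} {e₁ e₂ : Cₛ^∞⟮𝓡 m; F, E⟯} {r : ℝ}
    (h : ∀ᶠ y in 𝓝 x, 𝒞.pairing y (e₁ y) (e₂ y) = r) :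
    mfderiv (𝓡 m) 𝓘(ℝ, ℝ) (fun y => 𝒞.pairing y (e₁ y) (e₂ y)) x = 0 := by
  rw [Filter.EventuallyEq.mfderiv_eq (f := fun _ => r) h, mfderiv_const]
  rfl

variable {𝒞} in
theorem pairing_bracket_swap_right {x : M} {e₂ e₃ : Cₛ^∞⟮𝓡 m; F, E⟯} {r : ℝ}
    (h : ∀ᶠ y in 𝓝 x, 𝒞.pairing y (e₂ y) (e₃ y) = r) (e₁ : Cₛ^∞⟮𝓡 m; F, E⟯) :
    𝒞.pairing x (𝒞.bracket e₁ e₂ x) (e₃ x) = -𝒞.pairing x (𝒞.bracket e₁ e₃ x) (e₂ x) := by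
  have h1 := 𝒞.anchor_pairing e₁ e₂ e₃ x
  rw [mfderiv_pairing_eq_zero h, 𝒞.pairing_symm x (e₂ x) (𝒞.bracket e₁ e₃ x)] at h1
  exact eq_neg_of_add_eq_zero_left h1.symm

variable {𝒞} in
theorem pairing_bracket_swap_left {x : M} {e₁ e₂ : Cₛ^∞⟮𝓡 m; F, E⟯} {r : ℝ}
    (h : ∀ᶠ y in 𝓝 x, 𝒞.pairing y (e₁ y) (e₂ y) = r) (e₃ : Cₛ^∞⟮𝓡 m; F, E⟯) :
    𝒞.pairing x (𝒞.bracket e₁ e₂ x) (e₃ x) = -𝒞.pairing x (𝒞.bracket e₂ e₁ x) (e₃ x) := by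
  have h1 := 𝒞.bracket_symm_part e₁ e₂ e₃ x
  rw [mfderiv_pairing_eq_zero h, ContMDiffSection.coe_add, Pi.add_apply, map_add,
    LinearMap.add_apply] at h1
  exact eq_neg_of_add_eq_zero_left h1

/-- For sections of an isotropic family, `⟨e₁ ∘ e₂, e₃⟩` at a point is determined by its values on
sections spanning the family at that point. -/
theorem pairing_bracket_eq_zero_of_spanning {A : ∀ x, Submodule ℝ (E x)} {x : M}
    (hiso : ∀ y, IsIsotropic 𝒞 (A y)) {κ : Type*} {s : κ → Cₛ^∞⟮𝓡 m; F, E⟯}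
    (hs : ∀ k, ∀ᶠ y in 𝓝 x, s k y ∈ A y)
    (hspan : A x ≤ Submodule.span ℝ (Set.range fun k => s k x))
    (h0 : ∀ i j k, 𝒞.pairing x (𝒞.bracket (s i) (s j) x) (s k x) = 0)
    {e₁ e₂ e₃ : Cₛ^∞⟮𝓡 m; F, E⟯} (h₁ : ∀ᶠ y in 𝓝 x, e₁ y ∈ A y) (h₂ : ∀ᶠ y in 𝓝 x, e₂ y ∈ A y)
    (h₃ : ∀ᶠ y in 𝓝 x, e₃ y ∈ A y) :
    𝒞.pairing x (𝒞.bracket e₁ e₂ x) (e₃ x) = 0 := by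
  have hpair : ∀ {e e' : Cₛ^∞⟮𝓡 m; F, E⟯}, (∀ᶠ y in 𝓝 x, e y ∈ A y) →
      (∀ᶠ y in 𝓝 x, e' y ∈ A y) → ∀ᶠ y in 𝓝 x, 𝒞.pairing y (e y) (e' y) = 0 :=
    fun he he' => by
      filter_upwards [he, he'] with y hy hy' using hiso y _ hy _ hy'
  have hlin : ∀ (u : E x) {e : Cₛ^∞⟮𝓡 m; F, E⟯}, (∀ᶠ y in 𝓝 x, e y ∈ A y) →
      (∀ k, 𝒞.pairing x u (s k x) = 0) → 𝒞.pairing x u (e x) = 0 := fun u e he hu => by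
    have hle : Submodule.span ℝ (Set.range fun k => s k x) ≤ LinearMap.ker (𝒞.pairing x u) := by
      rw [Submodule.span_le]
      rintro _ ⟨k, rfl⟩
      exact hu k
    exact hle (hspan he.self_of_nhds)
  have key : ∀ i {e e' : Cₛ^∞⟮𝓡 m; F, E⟯}, (∀ᶠ y in 𝓝 x, e y ∈ A y) →
      (∀ᶠ y in 𝓝 x, e' y ∈ A y) → 𝒞.pairing x (𝒞.bracket (s i) e x) (e' x) = 0 :=
    fun i e e' he he' => hlin _ he' fun k => by
      rw [pairing_bracket_swap_right (hpair he (hs k)), hlin _ he (h0 i k), neg_zero]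
  -- The expression is linear in the value of the last argument only. Swaps bring each argument
  -- there in turn to be replaced by some `s k`, so no Leibniz rule for the bracket is needed.
  refine hlin _ h₃ fun k => ?_
  rw [pairing_bracket_swap_right (hpair h₂ (hs k)), pairing_bracket_swap_left (hpair h₁ (hs k)),
    key k h₁ h₂, neg_zero, neg_zero]

/-! ### Lagrangian subspaces -/

/-- The orthogonal of a subspace of a fibre. -/
def fiberOrthogonal {x : M} (W : Submodule ℝ (E x)) : Submodule ℝ (E x) :=
  LinearMap.BilinForm.orthogonal (𝒞.pairing x) W

variable {𝒞}

theorem mem_fiberOrthogonal {x : M} {W : Submodule ℝ (E x)} {u : E x} :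
    u ∈ fiberOrthogonal 𝒞 W ↔ ∀ w ∈ W, 𝒞.pairing x w u = 0 := Iff.rfl

theorem isIsotropic_iff_le {x : M} {W : Submodule ℝ (E x)} :
    IsIsotropic 𝒞 W ↔ W ≤ fiberOrthogonal 𝒞 W :=
  ⟨fun h u hu w hw => h w hw u hu, fun h u hu _ hv => h hv u hu⟩

theorem finrank_fiberOrthogonal {x : M} [FiniteDimensional ℝ (E x)] (W : Submodule ℝ (E x)) :
    Module.finrank ℝ (fiberOrthogonal 𝒞 W) = Module.finrank ℝ (E x) - Module.finrank ℝ W := by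
  refine LinearMap.BilinForm.finrank_orthogonal ?_ W
  refine ⟨fun u hu => 𝒞.pairing_nondeg x u hu, fun u hu => 𝒞.pairing_nondeg x u fun v => ?_⟩
  rw [𝒞.pairing_symm]
  exact hu v

theorem fiberOrthogonal_eq_of_isIsotropic {n : ℕ} {x : M} [FiniteDimensional ℝ (E x)]
    (hE : Module.finrank ℝ (E x) = 2 * n) {W : Submodule ℝ (E x)} (hW : Module.finrank ℝ W = n)
    (h : IsIsotropic 𝒞 W) : fiberOrthogonal 𝒞 W = W := by
  refine (Submodule.eq_of_le_of_finrank_eq (isIsotropic_iff_le.1 h) ?_).symm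
  rw [finrank_fiberOrthogonal, hE, hW]; omega

/-- The orthogonal has dimension `n`, so being isotropic it equals its own orthogonal; the latter
contains `W`, and dimensions agree. -/
theorem fiberOrthogonal_eq_of_isIsotropic_fiberOrthogonal {n : ℕ} {x : M}
    [FiniteDimensional ℝ (E x)] (hE : Module.finrank ℝ (E x) = 2 * n) {W : Submodule ℝ (E x)}
    (hW : Module.finrank ℝ W = n) (h : IsIsotropic 𝒞 (fiberOrthogonal 𝒞 W)) :
    fiberOrthogonal 𝒞 W = W := by
  have hf : Module.finrank ℝ (fiberOrthogonal 𝒞 W) = n := by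
    rw [finrank_fiberOrthogonal, hE, hW]; omega
  have h1 := fiberOrthogonal_eq_of_isIsotropic hE hf h
  have h2 : W ≤ fiberOrthogonal 𝒞 (fiberOrthogonal 𝒞 W) := fun w hw u hu => by
    rw [𝒞.pairing_symm]
    exact hu w hw
  exact (Submodule.eq_of_le_of_finrank_eq (h2.trans h1.le) (hW.trans hf.symm)).symm

/-- An isotropic space containing `W` lies in the orthogonal of `W`. -/
theorem maximal_isIsotropic_of_fiberOrthogonal_eq {x : M} {W : Submodule ℝ (E x)}
    (h : fiberOrthogonal 𝒞 W = W) : Maximal (IsIsotropic 𝒞) W := by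
  refine ⟨isIsotropic_iff_le.2 h.ge, fun W' hW' hle u hu => ?_⟩
  rw [← h]
  exact fun w hw => hW' w (hle hw) u hu

end Bracket

theorem exists_basis_of_eq_map {V V' : Type*} [AddCommGroup V] [Module ℝ V] [AddCommGroup V']
    [Module ℝ V'] {f : V →ₗ[ℝ] V'} (hf : Function.Injective f) {κ : Type*} {u : κ → V}
    (hu : LinearIndependent ℝ u) {W : Submodule ℝ V} (hW : W = Submodule.span ℝ (Set.range u))
    {W' : Submodule ℝ V'} (hW' : W' = W.map f) :
    ∃ w : Module.Basis κ ℝ W', ∀ k, (w k : V') = f (u k) := by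
  subst hW hW'
  refine ⟨(Module.Basis.span hu).map (Submodule.equivMapOfInjective f hf _), fun k => ?_⟩
  rw [Module.Basis.map_apply, Submodule.coe_equivMapOfInjective_apply, Module.Basis.span_apply]

/-! ### The restricted Hamiltonian vector field as a bilinear form on `ℬ` -/

section Hamiltonian

variable {m : ℕ} {Ω : TopologicalSpace.Opens (EuclideanSpace ℝ (Fin m))} {ι : Type} [Fintype ι]
  {V : Type*} [AddCommGroup V] [Module ℝ V] {v : ι → V} {W : Submodule ℝ (Module.Dual ℝ V)}
  {y : EuclideanSpace ℝ (Fin m)} {f : ι → Fin m → SmoothFun Ω} {h : ι → ι → ι → SmoothFun Ω}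
  {γ : ι → ℝ}

theorem Multivector.sum_eq_zero_of_restrict_eq_zero
    (h12 : ∀ a b d, (h a b d).1 y = -(h b a d).1 y)
    (h23 : ∀ a b d, (h a b d).1 y = -(h a d b).1 y)
    (h0 : restrict v W y (∑ e, γ e • derivOdd (.xi e) (cubic f h)) = 0) (u u' : W) :
    ∑ b, ∑ d, (∑ a, γ a * (h a b d).1 y) *
      (restrictedCoord v W b u * restrictedCoord v W d u') = 0 := by
  rw [restrict_sum_derivOdd_cubic v W y f h h12 h23, neg_eq_zero,
    smul_eq_zero_iff_right (by norm_num)] at h0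
  refine sum_eq_zero_of_exterior_eq_zero (fun b d => ?_) h0 u u'
  rw [← Finset.sum_neg_distrib]
  exact Finset.sum_congr rfl fun a _ => by rw [h23 a b d, mul_neg]

theorem Multivector.restrict_eq_zero_of_sum_eq_zero
    (h12 : ∀ a b d, (h a b d).1 y = -(h b a d).1 y)
    (h23 : ∀ a b d, (h a b d).1 y = -(h a d b).1 y) {κ : Type*} [Fintype κ]
    (w : Module.Basis κ ℝ W)
    (h0 : ∀ k l, ∑ b, ∑ d, (∑ a, γ a * (h a b d).1 y) *
      (restrictedCoord v W b (w k) * restrictedCoord v W d (w l)) = 0) :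
    restrict v W y (∑ e, γ e • derivOdd (.xi e) (cubic f h)) = 0 := by
  rw [restrict_sum_derivOdd_cubic v W y f h h12 h23,
    exterior_eq_zero_of_sum_eq_zero w h0, smul_zero, neg_zero]

end Hamiltonian

/-! ### Conormal covectors as vectors orthogonal to `A` -/

section Conormal

variable {m : ℕ} {M : Type*} [TopologicalSpace M] [ChartedSpace (EuclideanSpace ℝ (Fin m)) M]
  [IsManifold (𝓡 m) ∞ M]
  {F : Type*} [NormedAddCommGroup F] [NormedSpace ℝ F]
  {E : M → Type*} [TopologicalSpace (Bundle.TotalSpace F E)]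
  [∀ x, AddCommGroup (E x)] [∀ x, Module ℝ (E x)] [∀ x, TopologicalSpace (E x)]
  [FiberBundle F E] [VectorBundle ℝ F E] {𝒞 : CourantAlgebroid m M F E}

theorem mem_dualSubbundle_annihilator_iff (A : ∀ x, Submodule ℝ (E x)) {x : M} (u : E x) :
    (∀ β ∈ dualSubbundle 𝒞 A x, β u = 0) ↔ u ∈ fiberOrthogonal 𝒞 (A x) := by
  simp [dualSubbundle, mem_fiberOrthogonal]

end Conormal

/-! ### Structure functions in a Darboux chart, and the pointwise criterion in adapted charts -/

namespace DarbouxChart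

section Chart

open Topology

variable {m : ℕ} {M : Type*} [TopologicalSpace M] [ChartedSpace (EuclideanSpace ℝ (Fin m)) M]
  [IsManifold (𝓡 m) ∞ M]
  {F : Type*} [NormedAddCommGroup F] [NormedSpace ℝ F]
  {E : M → Type*} [TopologicalSpace (Bundle.TotalSpace F E)]
  [∀ x, AddCommGroup (E x)] [∀ x, Module ℝ (E x)] [∀ x, TopologicalSpace (E x)]
  [FiberBundle F E] [VectorBundle ℝ F E] {𝒞 : CourantAlgebroid m M F E}
  {ι : Type} (c : DarbouxChart 𝒞 ι)

theorem gram_isSymm {x : M} (hx : x ∈ c.chart.source)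
    : c.gram.IsSymm := by
  ext a b
  rw [Matrix.transpose_apply, ← c.gram_eq x hx, ← c.gram_eq x hx, 𝒞.pairing_symm]

theorem eventually_pairing_frame {x : M} (hx : x ∈ c.chart.source)
    (a b : ι) :
    ∀ᶠ y in 𝓝 x, 𝒞.pairing y (c.frame a y) (c.frame b y) = c.gram a b := by
  filter_upwards [c.chart.open_source.mem_nhds hx] with y hy using c.gram_eq y hy a b

theorem bracketFun_apply {x : M} (hx : x ∈ c.chart.source)
    (a b d : ι) : (c.bracketFun a b d).1 (c.chart x) =
    𝒞.pairing x (𝒞.bracket (c.frame a) (c.frame b) x) (c.frame d x) := by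
  simp only [bracketFun]
  rw [c.chart.left_inv hx]

theorem bracketFun_swap_right {x : M} (hx : x ∈ c.chart.source)
    (a b d : ι) :
    (c.bracketFun a b d).1 (c.chart x) = -(c.bracketFun a d b).1 (c.chart x) := by
  rw [c.bracketFun_apply hx, c.bracketFun_apply hx,
    pairing_bracket_swap_right (c.eventually_pairing_frame hx b d)]

theorem bracketFun_swap_left {x : M} (hx : x ∈ c.chart.source)
    (a b d : ι) :
    (c.bracketFun a b d).1 (c.chart x) = -(c.bracketFun b a d).1 (c.chart x) := by
  rw [c.bracketFun_apply hx, c.bracketFun_apply hx,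
    pairing_bracket_swap_left (c.eventually_pairing_frame hx a b)]

variable [Fintype ι]

theorem exists_coeff {x : M} (hx : x ∈ c.chart.source)
    (u : E x) : ∃ α : ι → ℝ, ∑ a, α a • c.frame a x = u := by
  have hu : u ∈ Submodule.span ℝ (Set.range fun a => c.frame a x) := by
    rw [c.frame_span x hx]; trivial
  exact (Submodule.mem_span_range_iff_exists_fun ℝ).1 hu

theorem pairing_sum_frame {x : M} (hx : x ∈ c.chart.source)
    (α β : ι → ℝ) :
    𝒞.pairing x (∑ a, α a • c.frame a x) (∑ b, β b • c.frame b x) =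
      α ⬝ᵥ c.gram.mulVec β := by
  simp only [map_sum, LinearMap.sum_apply, map_smul, LinearMap.smul_apply, c.gram_eq x hx,
    smul_eq_mul, dotProduct, Matrix.mulVec, Finset.mul_sum]
  refine Finset.sum_comm.trans (Finset.sum_congr rfl fun a _ => Finset.sum_congr rfl fun b _ => ?_)
  ring

variable [DecidableEq ι]

/-- A kernel vector of the Gram matrix would give a vector orthogonal to the whole fibre. -/
theorem gram_det_ne_zero {x : M} (hx : x ∈ c.chart.source)
    : c.gram.det ≠ 0 := by
  intro h
  obtain ⟨α, hα, hα0⟩ := Matrix.exists_mulVec_eq_zero_iff.2 h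
  refine hα ?_
  have hu : ∑ a, α a • c.frame a x = 0 := 𝒞.pairing_nondeg x _ fun v => by
    obtain ⟨β, rfl⟩ := c.exists_coeff hx v
    rw [𝒞.pairing_symm, c.pairing_sum_frame hx, hα0, dotProduct_zero]
  exact funext (Fintype.linearIndependent_iff.1 (c.frame_linearIndependent x hx) α hu)

theorem coeffH_apply (a b d : ι) (y : EuclideanSpace ℝ (Fin m)) : (c.coeffH a b d).1 y =
    ∑ a', ∑ b', ∑ d', c.gram⁻¹ a a' * c.gram⁻¹ b b' * c.gram⁻¹ d d' *
      (c.bracketFun a' b' d').1 y := by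
  simp [coeffH]

theorem coeffH_swap_right {x : M} (hx : x ∈ c.chart.source)
    (a b d : ι) :
    (c.coeffH a b d).1 (c.chart x) = -(c.coeffH a d b).1 (c.chart x) := by
  simp only [coeffH_apply, ← Finset.sum_neg_distrib]
  refine Finset.sum_congr rfl fun a' _ => Finset.sum_comm.trans <|
    Finset.sum_congr rfl fun b' _ => Finset.sum_congr rfl fun d' _ => ?_
  rw [c.bracketFun_swap_right hx a' d' b']
  ring

theorem coeffH_swap_left {x : M} (hx : x ∈ c.chart.source)
    (a b d : ι) :
    (c.coeffH a b d).1 (c.chart x) = -(c.coeffH b a d).1 (c.chart x) := by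
  simp only [coeffH_apply, ← Finset.sum_neg_distrib]
  refine Finset.sum_comm.trans <| Finset.sum_congr rfl fun a' _ =>
    Finset.sum_congr rfl fun b' _ => Finset.sum_congr rfl fun d' _ => ?_
  rw [c.bracketFun_swap_left hx b' a' d']
  ring

/-- The value `gᵏᵃ` is written as a vector with its index raised, the form that
`sum_contract_lowered` takes. -/
theorem restrictedCoord_apply {x : M} (hx : x ∈ c.chart.source)
    (A : ∀ x, Submodule ℝ (E x)) (a k : ι)
    {w : dualSubbundle 𝒞 A x} (hw : (w : Module.Dual ℝ (E x)) = 𝒞.pairing x (c.frame k x)) :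
    Multivector.restrictedCoord (fun a => c.frame a x) (dualSubbundle 𝒞 A x) a w =
      Matrix.vecMul (Pi.single k 1) c.gram a := by
  rw [Matrix.single_one_vecMul, Matrix.row_apply, ← c.gram_eq x hx, ← hw]
  rfl

/-- The contraction of the coefficients of the Hamiltonian with a covector and two frame
vectors. -/
theorem sum_coeffH {x : M} (hx : x ∈ c.chart.source)
    (A : ∀ x, Submodule ℝ (E x)) (α : ι → ℝ) (k l : ι)
    {w w' : dualSubbundle 𝒞 A x} (hw : (w : Module.Dual ℝ (E x)) = 𝒞.pairing x (c.frame k x))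
    (hw' : (w' : Module.Dual ℝ (E x)) = 𝒞.pairing x (c.frame l x)) :
    ∑ b, ∑ d, (∑ a, c.gram.mulVec α a * (c.coeffH a b d).1 (c.chart x)) *
      (Multivector.restrictedCoord (fun a => c.frame a x) (dualSubbundle 𝒞 A x) b w *
        Multivector.restrictedCoord (fun a => c.frame a x) (dualSubbundle 𝒞 A x) d w') =
      𝒞.pairing x (𝒞.bracket (c.frame k) (c.frame l) x) (∑ a, α a • c.frame a x) := by
  have hG : c.gram * c.gram⁻¹ = 1 :=
    Matrix.mul_nonsing_inv _ (isUnit_iff_ne_zero.2 (c.gram_det_ne_zero hx))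
  have hα : c.gram.mulVec α = Matrix.vecMul α c.gram := by
    rw [← Matrix.mulVec_transpose, c.gram_isSymm hx]
  simp only [c.restrictedCoord_apply hx A _ k hw, c.restrictedCoord_apply hx A _ l hw', hα,
    coeffH_apply]
  rw [sum_contract_lowered hG]
  simp only [Pi.single_apply, ite_mul, one_mul, zero_mul, mul_ite, mul_zero, Finset.sum_ite_eq',
    Finset.mem_univ, if_true, map_sum, map_smul, smul_eq_mul]
  refine Finset.sum_congr rfl fun a _ => ?_
  -- A cyclic permutation, hence even, moves the index contracted with `α` from the first slot to
  -- the last.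
  rw [c.bracketFun_swap_left hx, c.bracketFun_swap_right hx, neg_neg, c.bracketFun_apply hx]

end Chart

section Adapted

variable {m n : ℕ} {M : Type*} [TopologicalSpace M] [ChartedSpace (EuclideanSpace ℝ (Fin m)) M]
  [IsManifold (𝓡 m) ∞ M]
  {F : Type*} [NormedAddCommGroup F] [NormedSpace ℝ F]
  {E : M → Type*} [TopologicalSpace (Bundle.TotalSpace F E)]
  [∀ x, AddCommGroup (E x)] [∀ x, Module ℝ (E x)] [∀ x, TopologicalSpace (E x)]
  [FiberBundle F E] [VectorBundle ℝ F E] {𝒞 : CourantAlgebroid m M F E}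
  (c : DarbouxChart 𝒞 (Fin n ⊕ Fin n)) {A : ∀ x, Submodule ℝ (E x)}

theorem IsAdapted.frame_mem (hc : c.IsAdapted A) {x : M}
    (hx : x ∈ c.chart.source) (j : Fin n) : c.frame (Sum.inl j) x ∈ A x := by
  rw [hc x hx]
  exact Submodule.subset_span ⟨j, rfl⟩

/-- The fibre of `ℬ` has the basis `⟨ξ¹,·⟩, …, ⟨ξⁿ,·⟩`. -/
theorem IsAdapted.exists_basis (hc : c.IsAdapted A) {x : M}
    (hx : x ∈ c.chart.source) : ∃ w : Module.Basis (Fin n) ℝ (dualSubbundle 𝒞 A x),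
    ∀ k, (w k : Module.Dual ℝ (E x)) = 𝒞.pairing x (c.frame (Sum.inl k) x) := by
  refine exists_basis_of_eq_map ?_
    ((c.frame_linearIndependent x hx).comp Sum.inl Sum.inl_injective) (hc x hx) rfl
  rw [injective_iff_map_eq_zero]
  exact fun u hu => 𝒞.pairing_nondeg x u fun v => by rw [hu]; rfl

/-- In an adapted chart, the vanishing of `Q` on the conormal directions at a point says that `A` is
Lagrangian there and that the frame of `A` is closed under the bracket there. -/
theorem IsAdapted.vanishesOnConormal_iff (hc : c.IsAdapted A) {x : M}
    (hx : x ∈ c.chart.source) [FiniteDimensional ℝ (E x)]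
    (hE : Module.finrank ℝ (E x) = 2 * n) (hW : Module.finrank ℝ (A x) = n) :
    Multivector.VanishesOnConormal (fun a => c.frame a x) (dualSubbundle 𝒞 A x) (c.chart x)
        c.blendedQ ↔
      fiberOrthogonal 𝒞 (A x) = A x ∧ ∀ i j k : Fin n, 𝒞.pairing x
        (𝒞.bracket (c.frame (Sum.inl i)) (c.frame (Sum.inl j)) x) (c.frame (Sum.inl k) x) = 0 := by
  obtain ⟨w, hw⟩ := IsAdapted.exists_basis c hc hx
  rw [blendedQ, Multivector.vanishesOnConormal_iff _ _ _ (c.gram_isSymm hx)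
    (Θ := c.theta) (fun a => Multivector.derivEven_dxi_cubic _ _ a)]
  simp only [mem_dualSubbundle_annihilator_iff, theta]
  simp only [← c.pairing_sum_frame hx]
  constructor
  · rintro ⟨h1, h2⟩
    have hL : fiberOrthogonal 𝒞 (A x) = A x := by
      refine fiberOrthogonal_eq_of_isIsotropic_fiberOrthogonal hE hW fun u hu v hv => ?_
      obtain ⟨α, rfl⟩ := c.exists_coeff hx u
      obtain ⟨β, rfl⟩ := c.exists_coeff hx v
      exact h2 β α hv hu
    refine ⟨hL, fun i j k => ?_⟩
    have hs : ∑ a, (Pi.single (Sum.inl k) 1 : Fin n ⊕ Fin n → ℝ) a • c.frame a x =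
        c.frame (Sum.inl k) x := by
      simp [Pi.single_apply, ite_smul]
    -- Since `A^⊥ = A`, the frame vector `ξᵏ` of `A` is itself a conormal covector.
    have h := h1 (Pi.single (Sum.inl k) 1) (by
      rw [hs, hL]; exact IsAdapted.frame_mem c hc hx k)
    have h' := Multivector.sum_eq_zero_of_restrict_eq_zero (c.coeffH_swap_left hx)
      (c.coeffH_swap_right hx) h (w i) (w j)
    rwa [c.sum_coeffH hx A _ _ _ (hw i) (hw j), hs] at h'
  · rintro ⟨hL, hT⟩
    refine ⟨fun α hα => Multivector.restrict_eq_zero_of_sum_eq_zero (c.coeffH_swap_left hx)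
      (c.coeffH_swap_right hx) w fun k l => ?_, fun α β hα hβ => ?_⟩
    · rw [c.sum_coeffH hx A _ _ _ (hw k) (hw l)]
      rw [hL, hc x hx] at hα
      have hle : Submodule.span ℝ (Set.range fun j => c.frame (Sum.inl j) x) ≤ LinearMap.ker
          (𝒞.pairing x (𝒞.bracket (c.frame (Sum.inl k)) (c.frame (Sum.inl l)) x)) := by
        rw [Submodule.span_le]
        rintro _ ⟨j, rfl⟩
        exact hT k l j
      exact hle hα
    · rw [hL] at hβ
      exact hα _ hβ

end Adapted

end DarbouxChart

/-! ### Sections -/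

section Sections

open Topology

variable {m : ℕ} {M : Type*} [TopologicalSpace M] [ChartedSpace (EuclideanSpace ℝ (Fin m)) M]
  {F : Type*} [NormedAddCommGroup F] [NormedSpace ℝ F]
  {E : M → Type*} [TopologicalSpace (Bundle.TotalSpace F E)]
  [∀ x, AddCommGroup (E x)] [∀ x, Module ℝ (E x)] [∀ x, TopologicalSpace (E x)]
  [FiberBundle F E]

theorem exists_section_eq_sum_smul [VectorBundle ℝ F E] {κ : Type*} [Fintype κ] {f : κ → M → ℝ}
    (hf : ∀ k, ContMDiff (𝓡 m) 𝓘(ℝ, ℝ) ∞ (f k)) (s : κ → Cₛ^∞⟮𝓡 m; F, E⟯) :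
    ∃ t : Cₛ^∞⟮𝓡 m; F, E⟯, ∀ x, t x = ∑ k, f k x • s k x :=
  ⟨⟨fun x => ∑ k, f k x • s k x,
    ContMDiff.sum_section fun k _ => (hf k).smul_section (s k).contMDiff⟩, fun _ => rfl⟩

/-- A section lying in `A` near a point agrees at that point with a section lying in `A`
everywhere. -/
theorem exists_section_mem [T2Space M] [IsManifold (𝓡 m) ∞ M] [VectorBundle ℝ F E]
    {A : ∀ x, Submodule ℝ (E x)} {x : M} {s : Cₛ^∞⟮𝓡 m; F, E⟯} (hs : ∀ᶠ y in 𝓝 x, s y ∈ A y) :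
    ∃ t : Cₛ^∞⟮𝓡 m; F, E⟯, (∀ y, t y ∈ A y) ∧ t x = s x := by
  obtain ⟨f, -, hf⟩ := (SmoothBumpFunction.nhds_basis_support (I := 𝓡 m) hs).mem_iff.1 hs
  refine ⟨⟨fun y => f y • s y, f.contMDiff.smul_section s.contMDiff⟩, fun y => ?_, ?_⟩
  · change f y • s y ∈ A y
    by_cases hy : y ∈ Function.support f
    · exact (A y).smul_mem _ (hf hy)
    · rw [Function.notMem_support.1 hy, zero_smul]
      exact (A y).zero_mem
  · change f x • s x = s x
    rw [f.eq_one, one_smul]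

theorem exists_section_apply_eq [T2Space M] [IsManifold (𝓡 m) ∞ M] [VectorBundle ℝ F E]
    [ContMDiffVectorBundle ∞ F E (𝓡 m)] {x : M} (u : E x) : ∃ s : Cₛ^∞⟮𝓡 m; F, E⟯, s x = u := by
  obtain ⟨V, hV, hs⟩ := FiberBundle.exists_contMDiffOn_extend (k := ∞) (𝓡 m) F u
  obtain ⟨f, -, hf⟩ := (SmoothBumpFunction.nhds_basis_tsupport (I := 𝓡 m) x).mem_iff.1
    (interior_mem_nhds.2 hV)
  refine ⟨⟨fun y => f y • FiberBundle.extend F u y, ContMDiffOn.smul_section_of_tsupport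
    f.contMDiff.contMDiffOn isOpen_interior hf (hs.mono interior_subset)⟩, ?_⟩
  change f x • FiberBundle.extend F u x = u
  rw [f.eq_one, one_smul, FiberBundle.extend_apply_self]

variable (F) in
theorem nonempty_fiber_equiv [VectorBundle ℝ F E] (x : M) : Nonempty (F ≃ₗ[ℝ] E x) :=
  ⟨((trivializationAt F E x).linearEquivAt ℝ x (FiberBundle.mem_baseSet_trivializationAt' x)).symm⟩

theorem IsSubbundle.finrank_eq {A : ∀ x, Submodule ℝ (E x)} {n : ℕ} (hA : IsSubbundle m F A n)
    (x : M) : Module.finrank ℝ (A x) = n := by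
  obtain ⟨U, -, hxU, s, hs⟩ := hA x
  rw [(hs x hxU).2, finrank_span_eq_card (hs x hxU).1, Fintype.card_fin]

theorem contMDiff_det {κ : Type*} [Fintype κ] [DecidableEq κ] {P : M → Matrix κ κ ℝ}
    (hP : ∀ i j, ContMDiff (𝓡 m) 𝓘(ℝ, ℝ) ∞ fun y => P y i j) :
    ContMDiff (𝓡 m) 𝓘(ℝ, ℝ) ∞ fun y => (P y).det := by
  simp only [Matrix.det_apply']
  exact contMDiff_finsetSum fun σ _ =>
    contMDiff_const.mul (contMDiff_finsetProd fun i _ => hP (σ i) i)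

theorem contMDiff_adjugate {κ : Type*} [Fintype κ] [DecidableEq κ] {P : M → Matrix κ κ ℝ}
    (hP : ∀ i j, ContMDiff (𝓡 m) 𝓘(ℝ, ℝ) ∞ fun y => P y i j) (i j : κ) :
    ContMDiff (𝓡 m) 𝓘(ℝ, ℝ) ∞ fun y => (P y).adjugate i j := by
  simp only [Matrix.adjugate_apply]
  refine contMDiff_det fun k l => ?_
  simp only [Matrix.updateRow_apply]
  split_ifs
  · exact contMDiff_const
  · exact hP k l

end Sections

/-- A smooth function on the line that equals `u⁻¹` for `u ≥ 1/2`. -/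
theorem exists_contDiff_eq_inv :
    ∃ φ : ℝ → ℝ, ContDiff ℝ ∞ φ ∧ ∀ u, 1 / 2 ≤ u → φ u * u = 1 := by
  -- The cutoff is `0` for `u ≤ 1/4`, away from the pole of `u⁻¹` on the right, and `1` for `u ≥
  -- 1/2`.
  refine ⟨fun u => Real.smoothTransition (4 * u - 1) * u⁻¹, ?_, fun u hu => ?_⟩
  · rw [contDiff_iff_contDiffAt]
    intro u
    by_cases hu : u < 1 / 4
    · refine (contDiffAt_const (c := (0 : ℝ))).congr_of_eventuallyEq ?_
      filter_upwards [Iio_mem_nhds hu] with v hv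
      rw [Set.mem_Iio] at hv
      rw [Real.smoothTransition.zero_of_nonpos (by linarith), zero_mul]
    · refine ContDiffAt.mul ?_ (contDiffAt_inv ℝ (by rintro rfl; norm_num at hu))
      exact Real.smoothTransition.contDiffAt.comp u
        ((contDiffAt_const.mul contDiffAt_id).sub contDiffAt_const)
  · change Real.smoothTransition (4 * u - 1) * u⁻¹ * u = 1
    rw [Real.smoothTransition.one_of_one_le (by linarith), one_mul, inv_mul_cancel₀ (by linarith)]

/-! ### Existence of adapted Darboux charts -/

section Existence

open Topology

variable {m n : ℕ} {M : Type*} [TopologicalSpace M]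
  [ChartedSpace (EuclideanSpace ℝ (Fin m)) M] [IsManifold (𝓡 m) ∞ M]
  {F : Type*} [NormedAddCommGroup F] [NormedSpace ℝ F]
  {E : M → Type*} [TopologicalSpace (Bundle.TotalSpace F E)]
  [∀ x, AddCommGroup (E x)] [∀ x, Module ℝ (E x)] [∀ x, TopologicalSpace (E x)]
  [FiberBundle F E] [VectorBundle ℝ F E]
  {𝒞 : CourantAlgebroid m M F E}

/-- The map `v ↦ (⟨uᵢ, v⟩)ᵢ` has kernel the orthogonal of the span, of dimension `n`, so by
rank-nullity it is onto. -/
theorem exists_pairing_eq_single {x : M} [FiniteDimensional ℝ (E x)]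
    (hE : Module.finrank ℝ (E x) = 2 * n) {u : Fin n → E x} (hu : LinearIndependent ℝ u) :
    ∃ v : Fin n → E x, ∀ i j, 𝒞.pairing x (u i) (v j) = (1 : Matrix (Fin n) (Fin n) ℝ) i j := by
  let L : E x →ₗ[ℝ] Fin n → ℝ := LinearMap.pi fun i => 𝒞.pairing x (u i)
  have hker : LinearMap.ker L = fiberOrthogonal 𝒞 (Submodule.span ℝ (Set.range u)) := by
    ext v
    rw [LinearMap.mem_ker, mem_fiberOrthogonal]
    constructor
    · intro hv w hw
      have hle : Submodule.span ℝ (Set.range u) ≤ LinearMap.ker (𝒞.pairing x v) := by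
        rw [Submodule.span_le]
        rintro _ ⟨i, rfl⟩
        exact (𝒞.pairing_symm x v (u i)).trans (congrFun hv i)
      rw [𝒞.pairing_symm]
      exact hle hw
    · exact fun hv => funext fun i => hv _ (Submodule.subset_span ⟨i, rfl⟩)
  have hsurj : Function.Surjective L := by
    rw [← LinearMap.range_eq_top]
    refine Submodule.eq_top_of_finrank_eq ?_
    have h1 := LinearMap.finrank_range_add_finrank_ker L
    rw [hker, finrank_fiberOrthogonal, finrank_span_eq_card hu, Fintype.card_fin, hE] at h1
    rw [Module.finrank_fin_fun]
    omega
  choose v hv using fun j => hsurj fun i => (1 : Matrix (Fin n) (Fin n) ℝ) i j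
  exact ⟨v, fun i j => congrFun (hv j) i⟩

/-- A frame of a Lagrangian subbundle extends locally to a frame with constant pairings. -/
theorem exists_dual_sections [T2Space M] [ContMDiffVectorBundle ∞ F E (𝓡 m)] {x : M}
    [FiniteDimensional ℝ (E x)]
    (hE : Module.finrank ℝ (E x) = 2 * n) {s : Fin n → Cₛ^∞⟮𝓡 m; F, E⟯}
    (hs : LinearIndependent ℝ fun i => s i x)
    (hiso : ∀ᶠ y in 𝓝 x, ∀ i j, 𝒞.pairing y (s i y) (s j y) = 0) :
    ∃ t : Fin n → Cₛ^∞⟮𝓡 m; F, E⟯, ∀ᶠ y in 𝓝 x, ∀ i j,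
      𝒞.pairing y (s i y) (t j y) = (1 : Matrix (Fin n) (Fin n) ℝ) i j ∧
        𝒞.pairing y (t i y) (t j y) = 0 := by
  obtain ⟨v, hv⟩ := exists_pairing_eq_single (𝒞 := 𝒞) hE hs
  choose t₀ ht₀ using fun j => exists_section_apply_eq (m := m) (F := F) (v j)
  let P : M → Matrix (Fin n) (Fin n) ℝ := fun y => Matrix.of fun i j => 𝒞.pairing y (s i y) (t₀ j y)
  have hP : ∀ i j, ContMDiff (𝓡 m) 𝓘(ℝ, ℝ) ∞ fun y => P y i j :=
    fun i j => 𝒞.pairing_smooth (s i) (t₀ j)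
  have hPx : P x = 1 := by
    ext i j
    rw [← hv, ← ht₀ j]
    rfl
  obtain ⟨φ, hφ, hφ1⟩ := exists_contDiff_eq_inv
  have hdet := contMDiff_det hP
  have hev : ∀ᶠ y in 𝓝 x, φ (P y).det * (P y).det = 1 := by
    have : ∀ᶠ y in 𝓝 x, (1 / 2 : ℝ) < (P y).det :=
      hdet.continuous.continuousAt.eventually (lt_mem_nhds (by
        change 1 / 2 < (P x).det
        rw [hPx, Matrix.det_one]; norm_num))
    filter_upwards [this] with y hy using hφ1 _ hy.le
  -- Near `x` this is `t₀ P⁻¹`, which is dual to `s`. The inverse is the adjugate times `φ (det P)`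
  -- rather than `1 / det P`, to keep the coefficients smooth on all of `M`.
  choose t₁ ht₁ using fun j => exists_section_eq_sum_smul
    (f := fun k y => φ (P y).det * (P y).adjugate k j)
    (fun k => (hφ.comp_contMDiff hdet).mul (contMDiff_adjugate hP k j)) t₀
  have hst₁ : ∀ y, φ (P y).det * (P y).det = 1 → ∀ i j,
      𝒞.pairing y (s i y) (t₁ j y) = (1 : Matrix (Fin n) (Fin n) ℝ) i j := fun y hy i j => by
    have h := congrFun (congrFun (Matrix.mul_adjugate (P y)) i) j
    rw [Matrix.mul_apply, Matrix.smul_apply, smul_eq_mul] at h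
    rw [ht₁, map_sum, ← one_mul ((1 : Matrix (Fin n) (Fin n) ℝ) i j), ← hy, mul_assoc, ← h,
      Finset.mul_sum]
    refine Finset.sum_congr rfl fun k _ => ?_
    rw [map_smul, smul_eq_mul]
    change _ * 𝒞.pairing y (s i y) (t₀ k y) = _ * (𝒞.pairing y (s i y) (t₀ k y) * _)
    ring
  -- Subtracting `½ ∑ₖ ⟨t₁ⱼ, t₁ₖ⟩ sₖ` makes the dual frame isotropic: each of the two cross terms
  -- removes half of `⟨t₁ᵢ, t₁ⱼ⟩`. Duality survives because the `sₖ` are isotropic.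
  choose t₂ ht₂ using fun j => exists_section_eq_sum_smul
    (f := fun k y => (1 / 2 : ℝ) * 𝒞.pairing y (t₁ j y) (t₁ k y))
    (fun k => contMDiff_const.mul (𝒞.pairing_smooth (t₁ j) (t₁ k))) s
  refine ⟨fun j => t₁ j - t₂ j, ?_⟩
  filter_upwards [hev, hiso] with y hy hy0 i j
  have hss : ∀ i j, 𝒞.pairing y (s i y) (t₂ j y) = 0 := fun i j => by
    rw [ht₂, map_sum]
    exact Finset.sum_eq_zero fun k _ => by rw [map_smul, hy0, smul_zero]
  have htt : ∀ i j, 𝒞.pairing y (t₁ i y) (t₂ j y) = 1 / 2 * 𝒞.pairing y (t₁ i y) (t₁ j y) :=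
    fun i j => by
      have hts : ∀ k, 𝒞.pairing y (t₁ i y) (s k y) = (1 : Matrix (Fin n) (Fin n) ℝ) k i :=
        fun k => (𝒞.pairing_symm y _ _).trans (hst₁ y hy k i)
      rw [ht₂, map_sum]
      simp only [map_smul, hts, smul_eq_mul, Matrix.one_apply, mul_ite, mul_one, mul_zero,
        Finset.sum_ite_eq', Finset.mem_univ, if_true, 𝒞.pairing_symm y (t₁ j y)]
  have h22 : 𝒞.pairing y (t₂ i y) (t₂ j y) = 0 := by
    rw [ht₂ i, map_sum, LinearMap.sum_apply]
    exact Finset.sum_eq_zero fun k _ => by rw [map_smul, LinearMap.smul_apply, hss, smul_zero]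
  simp only [ContMDiffSection.coe_sub, Pi.sub_apply, map_sub, LinearMap.sub_apply]
  refine ⟨by rw [hst₁ y hy, hss, sub_zero], ?_⟩
  rw [h22, htt, 𝒞.pairing_symm y (t₂ i y), htt, 𝒞.pairing_symm y (t₁ j y)]
  ring

theorem linearIndependent_of_pairing {x : M} {u v : Fin n → E x}
    (huu : ∀ i j, 𝒞.pairing x (u i) (u j) = 0)
    (huv : ∀ i j, 𝒞.pairing x (u i) (v j) = (1 : Matrix (Fin n) (Fin n) ℝ) i j)
    (hvv : ∀ i j, 𝒞.pairing x (v i) (v j) = 0) : LinearIndependent ℝ (Sum.elim u v) := by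
  rw [Fintype.linearIndependent_iff]
  intro α hα
  rw [Fintype.sum_sum_type] at hα
  rintro (j | j)
  · have h := congrArg (𝒞.pairing x (v j)) hα
    simpa [map_sum, hvv, 𝒞.pairing_symm x (v j) (u _), huv, Matrix.one_apply] using h
  · have h := congrArg (𝒞.pairing x (u j)) hα
    simpa [map_sum, huu, huv, Matrix.one_apply] using h

/-- The frame of `A` and its isotropic dual form a hyperbolic frame with constant Gram matrix. Any
coordinate chart, shrunk to where both are defined, then serves. -/
theorem exists_adapted_chart [T2Space M] [ContMDiffVectorBundle ∞ F E (𝓡 m)]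
    [∀ x, FiniteDimensional ℝ (E x)]
    (hE : ∀ x, Module.finrank ℝ (E x) = 2 * n) {A : ∀ x, Submodule ℝ (E x)}
    (hA : IsSubbundle m F A n) (hiso : ∀ x, IsIsotropic 𝒞 (A x)) (x : M) :
    ∃ c : DarbouxChart 𝒞 (Fin n ⊕ Fin n), x ∈ c.chart.source ∧ c.IsAdapted A := by
  obtain ⟨U, hU, hxU, s, hs⟩ := hA x
  have hsU : ∀ y ∈ U, ∀ i, s i y ∈ A y := fun y hy i => by
    rw [(hs y hy).2]
    exact Submodule.subset_span ⟨i, rfl⟩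
  have hss : ∀ y ∈ U, ∀ i j, 𝒞.pairing y (s i y) (s j y) = 0 := fun y hy i j =>
    hiso y _ (hsU y hy i) _ (hsU y hy j)
  obtain ⟨t, ht⟩ := exists_dual_sections (hE x) (hs x hxU).1
    (Filter.eventually_of_mem (hU.mem_nhds hxU) hss)
  obtain ⟨V, hV, hVo, hxV⟩ := eventually_nhds_iff.1 ht
  have hUV : IsOpen (U ∩ V) := hU.inter hVo
  have hsrc : ((chartAt (EuclideanSpace ℝ (Fin m)) x).restr (U ∩ V)).source ⊆ U ∩ V := by
    rw [OpenPartialHomeomorph.restr_source' _ _ hUV]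
    exact Set.inter_subset_right
  have hframe : ∀ y, (fun a => (Sum.elim s t a : Cₛ^∞⟮𝓡 m; F, E⟯) y) =
      Sum.elim (fun i => s i y) (fun i => t i y) := fun y => by
    ext a
    cases a <;> rfl
  have hli : ∀ y ∈ U ∩ V, LinearIndependent ℝ
      (fun a => (Sum.elim s t a : Cₛ^∞⟮𝓡 m; F, E⟯) y) := fun y hy => by
    rw [hframe]
    exact linearIndependent_of_pairing (𝒞 := 𝒞) (hss y hy.1) (fun i j => (hV y hy.2 i j).1)
      (fun i j => (hV y hy.2 i j).2)
  refine ⟨{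
    chart := (chartAt (EuclideanSpace ℝ (Fin m)) x).restr (U ∩ V)
    chart_mem := restr_mem_maximalAtlas _ (IsManifold.chart_mem_maximalAtlas x) hUV
    frame := Sum.elim s t
    frame_linearIndependent := fun y hy => hli y (hsrc hy)
    frame_span := fun y hy => (hli y (hsrc hy)).span_eq_top_of_card_eq_finrank' (by
      rw [hE, Fintype.card_sum, Fintype.card_fin, two_mul])
    gram := Matrix.fromBlocks 0 1 1 0
    gram_eq := fun y hy a b => ?_ }, ?_, fun y hy => (hs y (hsrc hy).1).2⟩
  · have hy' := hsrc hy
    rcases a with i | i <;> rcases b with j | j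
    · exact hss y hy'.1 i j
    · exact (hV y hy'.2 i j).1
    · refine (𝒞.pairing_symm y _ _).trans ((hV y hy'.2 j i).1.trans ?_)
      rw [Matrix.fromBlocks_apply₂₁, Matrix.one_apply, Matrix.one_apply]
      simp only [eq_comm]
    · exact (hV y hy'.2 i j).2
  · rw [OpenPartialHomeomorph.restr_source' _ _ hUV]
    exact ⟨mem_chart_source _ x, hxU, hxV⟩

end Existence

/-! ### The two implications -/

section Main

open Topology

variable {m n : ℕ} {M : Type*} [TopologicalSpace M]
  [ChartedSpace (EuclideanSpace ℝ (Fin m)) M] [IsManifold (𝓡 m) ∞ M]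
  {F : Type*} [NormedAddCommGroup F] [NormedSpace ℝ F]
  {E : M → Type*} [TopologicalSpace (Bundle.TotalSpace F E)]
  [∀ x, AddCommGroup (E x)] [∀ x, Module ℝ (E x)] [∀ x, TopologicalSpace (E x)]
  [FiberBundle F E] [VectorBundle ℝ F E]
  {𝒞 : CourantAlgebroid m M F E} {A : ∀ x, Submodule ℝ (E x)}

theorem DarbouxChart.IsAdapted.eventually_mem {c : DarbouxChart 𝒞 (Fin n ⊕ Fin n)}
    (hc : c.IsAdapted A) {x : M} (hx : x ∈ c.chart.source) (j : Fin n) :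
    ∀ᶠ y in 𝓝 x, c.frame (Sum.inl j) y ∈ A y := by
  filter_upwards [c.chart.open_source.mem_nhds hx] with y hy
    using DarbouxChart.IsAdapted.frame_mem c hc hy j

/-- For a Dirac structure, `Q` vanishes on the conormal bundle in every adapted chart. -/
theorem IsDirac.isCoisotropic [T2Space M] [∀ x, FiniteDimensional ℝ (E x)]
    (hE : ∀ x, Module.finrank ℝ (E x) = 2 * n) (hA : IsSubbundle m F A n)
    (h : IsDirac 𝒞 A) {c : DarbouxChart 𝒞 (Fin n ⊕ Fin n)}
    (hc : c.IsAdapted A) : c.IsCoisotropic A := by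
  intro x hx
  have hiso : ∀ y, IsIsotropic 𝒞 (A y) := fun y => (h.maximal_isotropic y).prop
  rw [DarbouxChart.IsAdapted.vanishesOnConormal_iff c hc hx (hE x) (hA.finrank_eq x)]
  refine ⟨fiberOrthogonal_eq_of_isIsotropic (hE x) (hA.finrank_eq x) (hiso x), fun i j k => ?_⟩
  -- The frame is known to lie in `A` only over the chart domain. It is replaced by global sections
  -- of `A` with the same values at `x`, which suffice since only values at `x` matter.
  choose s hsA hsx using fun j => exists_section_mem (hc.eventually_mem hx j)
  refine pairing_bracket_eq_zero_of_spanning 𝒞 hiso (s := s)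
    (fun k => Filter.Eventually.of_forall (hsA k)) ?_ (fun i j k => ?_)
    (hc.eventually_mem hx i) (hc.eventually_mem hx j) (hc.eventually_mem hx k)
  · simp only [hsx]
    exact (hc x hx).le
  · exact hiso x _ (h.bracket_mem _ _ (hsA i) (hsA j) x) _ (hsA k x)

theorem IsOfCoisotropicType.isDirac [∀ x, FiniteDimensional ℝ (E x)]
    (hE : ∀ x, Module.finrank ℝ (E x) = 2 * n) (hA : IsSubbundle m F A n)
    (h : IsOfCoisotropicType n 𝒞 A) : IsDirac 𝒞 A := by
  choose c hxc hc hco using h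
  have key := fun x => (DarbouxChart.IsAdapted.vanishesOnConormal_iff (c x) (hc x) (hxc x)
    (hE x) (hA.finrank_eq x)).1 (hco x x (hxc x))
  have hmax : ∀ x, Maximal (IsIsotropic 𝒞) (A x) := fun x =>
    maximal_isIsotropic_of_fiberOrthogonal_eq (key x).1
  refine ⟨hmax, fun e₁ e₂ h₁ h₂ x => ?_⟩
  have hle : A x ≤ LinearMap.ker (𝒞.pairing x (𝒞.bracket e₁ e₂ x)) := by
    rw [hc x x (hxc x), Submodule.span_le]
    rintro _ ⟨k, rfl⟩
    exact pairing_bracket_eq_zero_of_spanning 𝒞 (fun y => (hmax y).prop)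
      (s := fun j => (c x).frame (Sum.inl j)) (fun k => (hc x).eventually_mem (hxc x) k)
      (hc x x (hxc x)).le (key x).2 (Filter.Eventually.of_forall h₁)
      (Filter.Eventually.of_forall h₂) ((hc x).eventually_mem (hxc x) k)
  -- The bracket is orthogonal to `A x`, hence lies in `A x`, which is its own orthogonal.
  rw [← (key x).1, mem_fiberOrthogonal]
  intro w hw
  rw [𝒞.pairing_symm]
  exact hle hw

end Main

end CourantDirac

end

theorem mainTheorem8 {m n : ℕ}
    {M : Type*} [TopologicalSpace M] [T2Space M]
    [ChartedSpace (EuclideanSpace ℝ (Fin m)) M] [IsManifold (𝓡 m) ∞ M]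
    {F : Type*} [NormedAddCommGroup F] [NormedSpace ℝ F] [FiniteDimensional ℝ F]
    {E : M → Type*} [TopologicalSpace (Bundle.TotalSpace F E)]
    [∀ x, AddCommGroup (E x)] [∀ x, Module ℝ (E x)] [∀ x, TopologicalSpace (E x)]
    [FiberBundle F E] [VectorBundle ℝ F E] [ContMDiffVectorBundle ∞ F E (𝓡 m)]
    (hrank : Module.finrank ℝ F = 2 * n)
    (𝒞 : CourantDirac.CourantAlgebroid m M F E)
    (A : ∀ x, Submodule ℝ (E x)) (hA : CourantDirac.IsSubbundle m F A n) :
    (CourantDirac.IsDirac 𝒞 A ↔ CourantDirac.IsOfCoisotropicType n 𝒞 A) ∧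
      (CourantDirac.IsOfCoisotropicType n 𝒞 A →
        ∀ c : CourantDirac.DarbouxChart 𝒞 (Fin n ⊕ Fin n), c.IsAdapted A → c.IsCoisotropic A) := by
  have hequiv := fun x => (CourantDirac.nonempty_fiber_equiv F (E := E) x).some
  have hfin : ∀ x, FiniteDimensional ℝ (E x) := fun x => (hequiv x).finiteDimensional
  have hE : ∀ x, Module.finrank ℝ (E x) = 2 * n := fun x =>
    (hequiv x).finrank_eq.symm.trans hrank
  -- Independence of the chart passes through the Dirac property.
  refine ⟨⟨fun h x => ?_, fun h => h.isDirac hE hA⟩,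
    fun h c hc => (h.isDirac hE hA).isCoisotropic hE hA hc⟩
  obtain ⟨c, hxc, hc⟩ := CourantDirac.exists_adapted_chart hE hA
    (fun x => (h.maximal_isotropic x).prop) x
  exact ⟨c, hxc, hc, h.isCoisotropic hE hA hc⟩
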